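/- Let $\mathbb R^N_n$ be $\mathbb R^N$ with the pseudo-Euclidean metric $-\sum_{j\le n}dx_j^2+\sum_{j>n}dx_j^2$, and let $0<k<m$. Let $M$ be a smooth $m$-dimensional manifold (Hausdorff, second countable, without boundary). (1) Let $m<N$ and let $\varphi:M\to\mathbb R^N_n$ be a smooth immersion whose induced metric $g=(g_{ij})$ is everywhere non-degenerate of index $k$ and which is minimal: its mean curvature vector $H=\sum_j\varepsilon_j h(e_j,e_j)$ vanishes identically, where $h$ is the second fundamental form and $(e_j)$ is a basis of the tangent space with $\langle e_i,e_j\rangle=\varepsilon_i\delta_{ij}$, $\varepsilon_j=-1$ for $j\le k$ and $\varepsilon_j=1$ for $j>k$. For Borel $A\subseteq M$ let $V_A(\varphi)=\int_A\sqrt{(-1)^k\det(g_{ij})}\,du^1\cdots du^m$. Then for every non-empty open set $\Omega\subseteq M$ (in particular for every domain) there are a compact set $K\subset\Omega$, an $\varepsilon>0$ and a smooth variation $\varphi_t$, $-\varepsilon<t<\varepsilon$, of $\varphi=\varphi_0$ such that every $\varphi_t$ has non-degenerate induced metric of index $k$, $\varphi_t=\varphi$ outside $K$, the variation field $\partial_t\varphi_t|_{t=0}$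 is normal, and $V_A(\varphi_t)>V_A(\varphi)$ for all $t\ne0$ and all Borel sets $A\supseteq K$ with $V_A(\varphi)<\infty$ (for instance $A=K$). There is also such a variation (with its own $K$ and $\varepsilon$) with $V_A(\varphi_t)<V_A(\varphi)$ for all these $t$ and $A$. (2) Let $\mathbb C^m_k$ be $\mathbb C^m$ with the pseudo-Hermitian metric $h_{(k,m)}=-\sum_{j\le k}dz_jd\bar z_j+\sum_{j>k}dz_jd\bar z_j=g-i\omega$. Let $\theta\in\mathbb R$ and let $\varphi:M\to\mathbb C^m_k$ be an indefinite $\theta$-special Lagrangian submanifold with $M$ oriented: $\varphi$ is smooth, $\varphi^*\omega=0$, $\varphi^*g$ is non-degenerate, and $e^{i\theta}dz_1\wedge\cdots\wedge dz_m$ takes the value $1$ on every oriented tangent basis $(e_j)$ with $\langle e_i,e_j\rangle=\varepsilon_i\delta_{ij}$. Then for every non-empty open $\Omega\subseteq M$, $\varphi$ is neither volume minimizing nor volume maximizing on $\Omega$: there are smooth variations $\varphi_t$ of $\varphi$ through maps with non-degenerate induced metric of index $k$, with normal variation field and fixed outside a compact $K\subset\Omega$, such that $V_K(\varphi_t)<V_K(\varphi)$,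 respectively $V_K(\varphi_t)>V_K(\varphi)$, for some $t$. -/

import Mathlib

open Set MeasureTheory
open scoped Manifold ContDiff ENNReal ComplexConjugate

noncomputable section

namespace IndefiniteSubmanifold

/-- The signs `ε_j` of a Lorentz basis of index `k`: `-1` for the first `k` indices, else `1`. -/
def sign (k : ℕ) {m : ℕ} (j : Fin m) : ℝ := if (j : ℕ) < k then -1 else 1

/-- The pseudo-Euclidean metric `-∑_{j ≤ n} dx_j² + ∑_{j > n} dx_j²` of `R_n^N`. -/
def pseudoEuclideanForm (n N : ℕ) : LinearMap.BilinForm ℝ (EuclideanSpace ℝ (Fin N)) :=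
  LinearMap.mk₂ ℝ (fun x y => ∑ j, sign n j * (x j * y j))
    (fun x x' y => by
      simp only [PiLp.add_apply, ← Finset.sum_add_distrib]
      exact Finset.sum_congr rfl fun j _ => by ring)
    (fun c x y => by
      simp only [PiLp.smul_apply, smul_eq_mul, Finset.mul_sum]
      exact Finset.sum_congr rfl fun j _ => by ring)
    (fun x y y' => by
      simp only [PiLp.add_apply, ← Finset.sum_add_distrib]
      exact Finset.sum_congr rfl fun j _ => by ring)
    (fun c x y => by
      simp only [PiLp.smul_apply, smul_eq_mul, Finset.mul_sum]
      exact Finset.sum_congr rfl fun j _ => by ring)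

/-- The pseudo-Hermitian metric `h = -∑_{j ≤ k} dz_j dz̄_j + ∑_{j > k} dz_j dz̄_j` of `C_k^m`. -/
def pseudoHermitian (k m : ℕ) (z w : EuclideanSpace ℂ (Fin m)) : ℂ :=
  ∑ j, (sign k j : ℂ) * (z j * conj (w j))

/-- The pseudo-Euclidean metric `g = Re h` of `C_k^m`, of real index `2k`. -/
def complexPseudoEuclideanForm (k m : ℕ) : LinearMap.BilinForm ℝ (EuclideanSpace ℂ (Fin m)) :=
  LinearMap.mk₂ ℝ (fun z w => (pseudoHermitian k m z w).re)
    (fun x x' y => by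
      simp only [pseudoHermitian, PiLp.add_apply, ← Complex.add_re, ← Finset.sum_add_distrib]
      exact congrArg Complex.re (Finset.sum_congr rfl fun j _ => by ring))
    (fun c x y => by
      simp only [pseudoHermitian, PiLp.smul_apply, Complex.real_smul, smul_eq_mul,
        ← Complex.re_ofReal_mul, Finset.mul_sum]
      exact congrArg Complex.re (Finset.sum_congr rfl fun j _ => by ring))
    (fun x y y' => by
      simp only [pseudoHermitian, PiLp.add_apply, map_add, ← Complex.add_re,
        ← Finset.sum_add_distrib]
      exact congrArg Complex.re (Finset.sum_congr rfl fun j _ => by ring))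
    (fun c x y => by
      simp only [pseudoHermitian, PiLp.smul_apply, Complex.real_smul, smul_eq_mul, map_mul,
        Complex.conj_ofReal, ← Complex.re_ofReal_mul, Finset.mul_sum]
      exact congrArg Complex.re (Finset.sum_congr rfl fun j _ => by ring))

/-- The symplectic form `ω` of `C_k^m`, where `h = g - i ω`. -/
def complexSymplecticForm (k m : ℕ) (z w : EuclideanSpace ℂ (Fin m)) : ℝ :=
  -(pseudoHermitian k m z w).im

/-- A symmetric bilinear form is nondegenerate with index `k`: the maximal dimension of a
negative definite subspace is `k`. -/
def HasIndex {V : Type*} [AddCommGroup V] [Module ℝ V] (g : LinearMap.BilinForm ℝ V) (k : ℕ) :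
    Prop :=
  g.Nondegenerate ∧ sigNeg g.toQuadraticMap = k

/-- A Lorentz basis: `⟨e_i, e_j⟩ = ε_i δ_{ij}`, the first `k` vectors being timelike. -/
def IsLorentzBasis {V : Type*} [AddCommGroup V] [Module ℝ V] (g : LinearMap.BilinForm ℝ V)
    (k : ℕ) {m : ℕ} (e : Module.Basis (Fin m) ℝ V) : Prop :=
  ∀ i j, g (e i) (e j) = if i = j then sign k i else 0

section Geometry

variable (m : ℕ) {M : Type*} [TopologicalSpace M] [ChartedSpace (EuclideanSpace ℝ (Fin m)) M]
  {E : Type*} [NormedAddCommGroup E] [NormedSpace ℝ E]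

/-- The differential `T_pM → E` of a map into the vector space `E`. -/
def differential (φ : M → E) (p : M) : TangentSpace (𝓡 m) p →ₗ[ℝ] E :=
  (mfderiv (𝓡 m) 𝓘(ℝ, E) φ p).toLinearMap

/-- The metric induced on `T_pM` from the bilinear form `B` of the ambient space. -/
def inducedMetric (B : LinearMap.BilinForm ℝ E) (φ : M → E) (p : M) :
    LinearMap.BilinForm ℝ (TangentSpace (𝓡 m) p) :=
  B.comp (differential m φ p) (differential m φ p)

/-- `φ : M → (E, B)` is a smooth indefinite submanifold whose induced metric has index `k`.
Nondegeneracy of the induced metric makes `φ` an immersion. -/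
def IsIndefiniteSubmanifold (B : LinearMap.BilinForm ℝ E) (k : ℕ) (φ : M → E) : Prop :=
  ContMDiff (𝓡 m) 𝓘(ℝ, E) ∞ φ ∧ ∀ p, HasIndex (inducedMetric m B φ p) k

/-- The tangent plane `dφ(T_pM)` as a subspace of the ambient space. -/
def tangentPlane (φ : M → E) (p : M) : Submodule ℝ E := LinearMap.range (differential m φ p)

/-- The normal space `T_p^⊥M`, the orthogonal complement with respect to `B`. -/
def normalSpace (B : LinearMap.BilinForm ℝ E) (φ : M → E) (p : M) : Submodule ℝ E :=
  B.orthogonal (tangentPlane m φ p)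

open Classical in
/-- The projection of `E = T_pM ⊕ T_p^⊥M` onto the normal space. The decomposition holds whenever
the induced metric is nondegenerate; otherwise the value is the junk value `0`. -/
def normalProjection (B : LinearMap.BilinForm ℝ E) (φ : M → E) (p : M) : E →ₗ[ℝ] E :=
  if h : IsCompl (normalSpace m B φ p) (tangentPlane m φ p) then
    (normalSpace m B φ p).projection (tangentPlane m φ p) h
  else 0

/-- The second fundamental form `h(v, w) = (D_v W)^⊥`: the normal part of the second derivative
of `φ` in the preferred chart at `p`, the chart by which Mathlib identifies `T_pM` with `ℝ^m`. -/
def secondFundamentalForm (B : LinearMap.BilinForm ℝ E) (φ : M → E) (p : M)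
    (v w : TangentSpace (𝓡 m) p) : E :=
  normalProjection m B φ p
    (fderiv ℝ (fderiv ℝ (φ ∘ (extChartAt (𝓡 m) p).symm)) (extChartAt (𝓡 m) p p) v w)

/-- The mean curvature vector `H = ∑_j ε_j h(e_j, e_j)`, computed in the Lorentz basis `e`. -/
def meanCurvature (B : LinearMap.BilinForm ℝ E) (k : ℕ) (φ : M → E) (p : M)
    (e : Module.Basis (Fin m) ℝ (TangentSpace (𝓡 m) p)) : E :=
  ∑ j, sign k j • secondFundamentalForm m B φ p (e j) (e j)

/-- Minimality, `H ≡ 0`. -/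
def IsMinimal (B : LinearMap.BilinForm ℝ E) (k : ℕ) (φ : M → E) : Prop :=
  ∀ (p : M) (e : Module.Basis (Fin m) ℝ (TangentSpace (𝓡 m) p)),
    IsLorentzBasis (inducedMetric m B φ p) k e → meanCurvature m B k φ p e = 0

/-- The matrix `(g_ij)` of the induced metric in the coordinates of the chart `c`, at `u`. -/
def coordinateMetric (B : LinearMap.BilinForm ℝ E) (φ : M → E)
    (c : OpenPartialHomeomorph M (EuclideanSpace ℝ (Fin m))) (u : EuclideanSpace ℝ (Fin m)) :
    Matrix (Fin m) (Fin m) ℝ :=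
  Matrix.of fun i j =>
    B (fderiv ℝ (φ ∘ c.symm) u (EuclideanSpace.single i 1))
      (fderiv ℝ (φ ∘ c.symm) u (EuclideanSpace.single j 1))

/-- `∫_{c(S)} √((-1)^k det (g_ij)) du`, the volume of a piece `S` of `M` inside the domain of the
chart `c`. -/
def chartVolume (B : LinearMap.BilinForm ℝ E) (k : ℕ) (φ : M → E)
    (c : OpenPartialHomeomorph M (EuclideanSpace ℝ (Fin m))) (S : Set M) : ℝ≥0∞ :=
  ∫⁻ u in c '' S, ENNReal.ofReal (Real.sqrt ((-1) ^ k * (coordinateMetric m B φ c u).det))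

/-- The volume of `A ⊆ M` in the metric induced by `φ`: the supremum, over the finite families of
disjoint Borel pieces of `A` each of which lies in a smooth chart, of the sum of the volumes of the
pieces. By the change of variables formula each piece may be computed in any chart, and this is the
integral of `√((-1)^k det (g_ij)) du^1 ∧ ⋯ ∧ du^m` over `A`. -/
def volumeOn (B : LinearMap.BilinForm ℝ E) (k : ℕ) (φ : M → E) (A : Set M) : ℝ≥0∞ :=
  ⨆ (r : ℕ) (c : Fin r → OpenPartialHomeomorph M (EuclideanSpace ℝ (Fin m)))
    (S : Fin r → Set M)
    (_ : ∀ i, c i ∈ IsManifold.maximalAtlas (𝓡 m) ∞ M ∧ MeasurableSet[borel M] (S i) ∧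
      S i ⊆ A ∩ (c i).source)
    (_ : Pairwise fun i j => Disjoint (S i) (S j)),
    ∑ i, chartVolume m B k φ (c i) (S i)

/-- `Φ_t`, `-ε < t < ε`, is a smooth variation of `φ` through submanifolds of index `k`, fixed
outside the set `K`, whose variation vector field `∂_t Φ_t|_{t = 0}` is normal to `φ`. -/
structure IsVariation (B : LinearMap.BilinForm ℝ E) (k : ℕ) (φ : M → E) (K : Set M) (ε : ℝ)
    (Φ : ℝ → M → E) : Prop where
  smooth : ContMDiffOn (𝓘(ℝ, ℝ).prod (𝓡 m)) 𝓘(ℝ, E) ∞ (fun q : ℝ × M => Φ q.1 q.2)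
    (Ioo (-ε) ε ×ˢ univ)
  zero : Φ 0 = φ
  fixed : ∀ t ∈ Ioo (-ε) ε, ∀ p, p ∉ K → Φ t p = φ p
  index : ∀ t ∈ Ioo (-ε) ε, ∀ p, HasIndex (inducedMetric m B (Φ t) p) k
  normal : ∀ p, deriv (fun t => Φ t p) 0 ∈ normalSpace m B φ p

/-- The variation strictly increases the volume: so it does for the support set `K`, whose volume
is finite, and for every larger Borel set of finite volume. -/
def IncreasesVolume (B : LinearMap.BilinForm ℝ E) (k : ℕ) (φ : M → E) (K : Set M) (ε : ℝ)
    (Φ : ℝ → M → E) : Prop :=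
  volumeOn m B k φ K ≠ ⊤ ∧
  ∀ t ∈ Ioo (-ε) ε, t ≠ 0 → ∀ A : Set M, MeasurableSet[borel M] A → K ⊆ A →
    volumeOn m B k φ A ≠ ⊤ → volumeOn m B k φ A < volumeOn m B k (Φ t) A

/-- The variation strictly decreases the volume, in the same sense. -/
def DecreasesVolume (B : LinearMap.BilinForm ℝ E) (k : ℕ) (φ : M → E) (K : Set M) (ε : ℝ)
    (Φ : ℝ → M → E) : Prop :=
  volumeOn m B k φ K ≠ ⊤ ∧
  ∀ t ∈ Ioo (-ε) ε, t ≠ 0 → ∀ A : Set M, MeasurableSet[borel M] A → K ⊆ A →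
    volumeOn m B k φ A ≠ ⊤ → volumeOn m B k (Φ t) A < volumeOn m B k φ A

/-- `φ` is volume minimizing on `Ω`: no compactly supported variation in `Ω` lowers the volume. -/
def IsVolumeMinimizingOn (B : LinearMap.BilinForm ℝ E) (k : ℕ) (φ : M → E) (Ω : Set M) : Prop :=
  ∀ (K : Set M) (ε : ℝ) (Φ : ℝ → M → E), IsCompact K → K ⊆ Ω → 0 < ε →
    IsVariation m B k φ K ε Φ → ∀ t ∈ Ioo (-ε) ε, volumeOn m B k φ K ≤ volumeOn m B k (Φ t) K

/-- `φ` is volume maximizing on `Ω`: no compactly supported variation in `Ω` raises the volume. -/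
def IsVolumeMaximizingOn (B : LinearMap.BilinForm ℝ E) (k : ℕ) (φ : M → E) (Ω : Set M) : Prop :=
  ∀ (K : Set M) (ε : ℝ) (Φ : ℝ → M → E), IsCompact K → K ⊆ Ω → 0 < ε →
    IsVariation m B k φ K ε Φ → ∀ t ∈ Ioo (-ε) ε, volumeOn m B k (Φ t) K ≤ volumeOn m B k φ K

variable {m}

/-- `φ : M → C_k^m` is Lagrangian: `φ^*ω = 0` and `φ^*g` is nondegenerate. -/
def IsLagrangian (k : ℕ) (φ : M → EuclideanSpace ℂ (Fin m)) : Prop :=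
  ContMDiff (𝓡 m) 𝓘(ℝ, EuclideanSpace ℂ (Fin m)) ∞ φ ∧
  (∀ p, (inducedMetric m (complexPseudoEuclideanForm k m) φ p).Nondegenerate) ∧
  ∀ p (v w : TangentSpace (𝓡 m) p),
    complexSymplecticForm k m (differential m φ p v) (differential m φ p w) = 0

/-- The holomorphic `m`-form `dz_θ = e^{iθ} dz_1 ∧ ⋯ ∧ dz_m`. -/
def holomorphicForm (θ : ℝ) (v : Fin m → EuclideanSpace ℂ (Fin m)) : ℂ :=
  Complex.exp (θ * Complex.I) * (Matrix.of fun i j => v j i).det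

/-- `φ` is an indefinite `θ`-special Lagrangian submanifold for the orientation `o` of `M`: it is
Lagrangian and `dz_θ(TM) ≡ 1`, that is, `dz_θ` takes the value `1` on the oriented Lorentz bases of
the tangent planes. Only one orientation satisfies this, and it is automatically continuous. -/
def IsSpecialLagrangian (k : ℕ) (θ : ℝ) (φ : M → EuclideanSpace ℂ (Fin m))
    (o : ∀ p : M, Orientation ℝ (TangentSpace (𝓡 m) p) (Fin m)) : Prop :=
  IsLagrangian k φ ∧
  ∀ (p : M) (e : Module.Basis (Fin m) ℝ (TangentSpace (𝓡 m) p)),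
    IsLorentzBasis (inducedMetric m (complexPseudoEuclideanForm k m) φ p) k e →
    e.orientation = o p → holomorphicForm θ (fun j => differential m φ p (e j)) = 1

end Geometry

end IndefiniteSubmanifold

end

/-!
The variations are `φ_t = φ + t f ξ`, where `ξ` is a non-null normal field near a point and `f` has
compact support in a coordinate ball. As `⟨dφ, ξ⟩ = 0`, the Gram matrix of `φ_t` is exactly
`g + t f C + t² G`, where `C` is the polarised form of `dφ` and `dξ`, and `G` is the Gram matrix of
`d(f ξ)`. Minimality is `tr (g⁻¹ C) = 0` (`IsMinimal.trace_crossMatrix_eq_zero`), hence the volume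
has no first order term in `t`, and the sign of its second derivative decides
(`eventually_integral_sqrt_det`).

The second derivative is quadratic in `(f, df)`, and `df` enters to second order only through
`⟨ξ, ξ⟩ g⁻¹(df, df)`. For `f = η cos (λ ℓ)` and `f = η sin (λ ℓ)`, with a cut-off `η` and a linear
`ℓ`, the two second derivatives add up to a constant plus `λ²` times the integral of
`√|det g| η² ⟨ξ, ξ⟩ g⁻¹(ℓ, ℓ)`; so for large `λ` one of them has the sign of `⟨ξ, ξ⟩ g⁻¹(ℓ, ℓ)`
(`exists_oscillation`). As `g` is indefinite, `ℓ` can be chosen to give either sign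
(`exists_variation`). Since the volume is additive along a compact piece inside a chart and `φ_t`
differs from `φ` only there, the comparison holds for all larger Borel sets of finite volume
(`volumeOn_eq_chartVolume_add`, `exists_increasing_and_decreasing_variation`).

A special Lagrangian submanifold of `C_k^m` falls under this result, because its codimension `m` is
positive, its index is `k` and it is minimal. A Lorentz basis of a Lagrangian tangent plane is a
complex basis that diagonalises the pseudo-Hermitian metric, and the Hermitian law of inertia gives
the index (`IsLagrangian.hasIndex`). As `ω` vanishes, `⟨h(u, v), i w⟩` is a symmetric cubic form;
its trace is the derivative of the phase of `dz_1 ∧ ⋯ ∧ dz_m`, which is constant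
(`sum_second_derivative_eq_zero`, `IsSpecialLagrangian.isMinimal`).
-/

noncomputable section

namespace IndefiniteSubmanifold

/-! ### Bilinear forms of a given index -/

lemma sign_mul_self (k : ℕ) {m : ℕ} (j : Fin m) : sign k j * sign k j = 1 := by
  unfold sign; split_ifs <;> norm_num

lemma sign_eq_neg_one {k m : ℕ} {j : Fin m} (h : (j : ℕ) < k) : sign k j = -1 := if_pos h

lemma sign_eq_one {k m : ℕ} {j : Fin m} (h : ¬ (j : ℕ) < k) : sign k j = 1 := if_neg h

section Forms

variable {V : Type*} [AddCommGroup V] [Module ℝ V]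

lemma apply_eq_sum_repr {m : ℕ} (g : LinearMap.BilinForm ℝ V) (e : Module.Basis (Fin m) ℝ V)
    (v w : V) : g v w = ∑ i, ∑ j, e.repr v i * e.repr w j * g (e i) (e j) := by
  conv_lhs => rw [← e.sum_repr v, ← e.sum_repr w]
  simp only [map_sum, LinearMap.sum_apply, map_smul, LinearMap.smul_apply, smul_eq_mul,
    Finset.mul_sum]
  rw [Finset.sum_comm]
  exact Finset.sum_congr rfl fun i _ => Finset.sum_congr rfl fun j _ => by ring

lemma abs_apply_self_sub_le {k m : ℕ} (g : LinearMap.BilinForm ℝ V)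
    (e : Module.Basis (Fin m) ℝ V) {δ : ℝ}
    (h : ∀ i j, |g (e i) (e j) - if i = j then sign k i else 0| ≤ δ) (v : V) :
    |g v v - ∑ i, sign k i * e.repr v i ^ 2| ≤ δ * m * ∑ i, e.repr v i ^ 2 := by
  set a := e.repr v
  have h1 : g v v - ∑ i, sign k i * a i ^ 2
      = ∑ i, ∑ j, a i * a j * (g (e i) (e j) - if i = j then sign k i else 0) := by
    rw [apply_eq_sum_repr g e v v, ← Finset.sum_sub_distrib]
    refine Finset.sum_congr rfl fun i _ => ?_
    simp only [mul_sub, Finset.sum_sub_distrib, mul_ite, mul_zero, Finset.sum_ite_eq,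
      Finset.mem_univ, if_true]
    congr 1; ring
  rw [h1]
  calc |∑ i, ∑ j, a i * a j * (g (e i) (e j) - if i = j then sign k i else 0)|
      ≤ ∑ i, ∑ j, |a i * a j * (g (e i) (e j) - if i = j then sign k i else 0)| :=
        (Finset.abs_sum_le_sum_abs _ _).trans
          (Finset.sum_le_sum fun i _ => Finset.abs_sum_le_sum_abs _ _)
    _ ≤ ∑ i, ∑ j, δ * ((a i ^ 2 + a j ^ 2) / 2) := by
        refine Finset.sum_le_sum fun i _ => Finset.sum_le_sum fun j _ => ?_
        rw [abs_mul, abs_mul, mul_comm]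
        refine mul_le_mul (h i j) ?_ (by positivity) ((abs_nonneg _).trans (h i j))
        nlinarith [sq_nonneg (|a i| - |a j|), sq_abs (a i), sq_abs (a j)]
    _ = δ * m * ∑ i, a i ^ 2 := by
        simp only [← Finset.mul_sum, ← Finset.sum_div, Finset.sum_add_distrib, Finset.sum_const,
          Finset.card_univ, Fintype.card_fin, nsmul_eq_mul]
        ring

/-- Having index `k` is an open condition: a form whose Gram matrix in some basis is close to
`diag(ε_j)` is definite on the spans of the timelike and of the spacelike basis vectors. -/
lemma hasIndex_of_close {k m : ℕ} (hkm : k ≤ m) (g : LinearMap.BilinForm ℝ V)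
    (hg : ∀ x y, g x y = g y x) (e : Module.Basis (Fin m) ℝ V)
    (h : ∀ i j, |g (e i) (e j) - if i = j then sign k i else 0| ≤ 1 / (m + 1)) :
    HasIndex g k := by
  obtain ⟨l, rfl⟩ := Nat.exists_eq_add_of_le hkm
  have : FiniteDimensional ℝ V := e.finiteDimensional_of_finite
  have hV : Module.finrank ℝ V = k + l := by simp [Module.finrank_eq_card_basis e]
  have hpos : ∀ v : V, v ≠ 0 → 0 < ∑ i, e.repr v i ^ 2 := fun v hv => by
    have : e.repr v ≠ 0 := by simpa using hv
    obtain ⟨i, hi⟩ := Finsupp.ne_iff.1 this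
    exact Finset.sum_pos' (fun _ _ => sq_nonneg _) ⟨i, Finset.mem_univ _, by
      have : e.repr v i ≠ 0 := hi
      positivity⟩
  have hlt : ∀ v : V, v ≠ 0 →
      |g v v - ∑ i, sign k i * e.repr v i ^ 2| < ∑ i, e.repr v i ^ 2 := fun v hv => by
    refine (abs_apply_self_sub_le g e h v).trans_lt ?_
    refine mul_lt_of_lt_one_left (hpos v hv) ?_
    rw [one_div, ← div_eq_inv_mul, div_lt_one (by positivity)]
    linarith
  have key : ∀ (ι : Type) [Fintype ι] (f : ι → Fin (k + l)) (s : ℝ), Function.Injective f →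
      s * s = 1 → (∀ i, sign k (f i) = s) →
      ∃ W : Submodule ℝ V, Module.finrank ℝ W = Fintype.card ι ∧
        ∀ v ∈ W, v ≠ 0 → 0 < s * g v v := by
    intro ι _ f s hf hs hfs
    refine ⟨Submodule.span ℝ (range (e ∘ f)),
      finrank_span_eq_card (e.linearIndependent.comp f hf), fun v hv hv0 => ?_⟩
    rw [range_comp, Module.Basis.mem_span_image] at hv
    have : ∑ i, sign k i * e.repr v i ^ 2 = s * ∑ i, e.repr v i ^ 2 := by
      rw [Finset.mul_sum]
      refine Finset.sum_congr rfl fun i _ => ?_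
      by_cases hi : e.repr v i = 0
      · simp [hi]
      · obtain ⟨j, rfl⟩ := hv (Finset.mem_coe.2 (Finsupp.mem_support_iff.2 hi))
        rw [hfs]
    have h1 := abs_lt.1 (hlt v hv0)
    rw [this] at h1
    rcases mul_self_eq_one_iff.1 hs with rfl | rfl <;> linarith [h1.1, h1.2]
  obtain ⟨W, hW, hWn⟩ := key (Fin k) (Fin.castAdd l) (-1) (Fin.castAdd_injective k l) (by norm_num)
    fun i => sign_eq_neg_one (by simp)
  obtain ⟨W', hW', hWp⟩ := key (Fin l) (Fin.natAdd k) 1 (Fin.natAdd_injective l k) (by norm_num)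
    fun i => sign_eq_one (by simp)
  have hn := le_sigNeg_of_negDef (Q := g.toQuadraticMap) (V := W) fun x hx => by
    simpa using hWn x x.2 (by simpa using hx)
  have hp := le_sigPos_of_posDef (Q := g.toQuadraticMap) (V := W') fun x hx => by
    simpa using hWp x x.2 (by simpa using hx)
  have hsum := QuadraticForm.sigPos_add_sigNeg_add_radical (Q := g.toQuadraticMap)
  simp only [hW, hW', Fintype.card_fin] at hn hp
  have hrad : g.toQuadraticMap.radical = ⊥ := Submodule.finrank_eq_zero.1 (by omega)
  have hleft : ∀ x, (∀ y, g x y = 0) → x = 0 := fun x hx => by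
    have : x ∈ g.toQuadraticMap.radical := by
      refine ⟨by simp [hx], ?_⟩
      ext y
      simp [QuadraticMap.polar, hx, hg y x]
    simpa [hrad] using this
  exact ⟨⟨hleft, fun y hy => hleft y fun x => by rw [hg]; exact hy x⟩, by omega⟩

/-- Sylvester's law of inertia, with the timelike vectors listed first. -/
lemma HasIndex.exists_isLorentzBasis {k m : ℕ} [FiniteDimensional ℝ V]
    (hV : Module.finrank ℝ V = m) {g : LinearMap.BilinForm ℝ V} (hg : ∀ x y, g x y = g y x)
    (h : HasIndex g k) : ∃ e : Module.Basis (Fin m) ℝ V, IsLorentzBasis g k e := by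
  subst hV
  have hassoc : QuadraticMap.associated (R := ℝ) g.toQuadraticMap = g :=
    QuadraticMap.associated_left_inverse ℝ hg
  obtain ⟨w, hw, hQ⟩ := QuadraticForm.equivalent_one_neg_one_weighted_sum_squared
    g.toQuadraticMap (by rw [hassoc]; exact h.1.1)
  have hcard : {i | w i < 0}.ncard = k := by
    rw [← QuadraticForm.sigNeg_of_equiv_weightedSumSquares hQ, h.2]
  have hk : k ≤ Module.finrank ℝ V := by
    rw [← hcard]; simpa using Set.ncard_le_card {i | w i < 0}
  obtain ⟨φ⟩ := hQ
  have : Nonempty ({i : Fin (Module.finrank ℝ V) // (i : ℕ) < k} ≃ {i // w i < 0}) := by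
    refine Finite.card_eq.1 ?_
    change _ = Nat.card ({i | w i < 0} : Set _)
    rw [Nat.card_coe_set_eq, hcard]
    refine (Nat.card_congr
      { toFun := fun i => (⟨i.1.1, i.2⟩ : Fin k)
        invFun := fun i => ⟨⟨i.1, i.2.trans_le hk⟩, i.2⟩
        left_inv := fun i => rfl
        right_inv := fun i => rfl }).trans (by simp)
  obtain ⟨τ⟩ := this
  set σ : Equiv.Perm (Fin (Module.finrank ℝ V)) := τ.extendSubtype
  have hσ : ∀ i, w (σ i) = sign k i := fun i => by
    by_cases hi : (i : ℕ) < k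
    · have : w (σ i) < 0 := τ.extendSubtype_mem i hi
      rw [sign_eq_neg_one hi]
      rcases hw (σ i) with h | h <;> linarith
    · have : ¬ w (σ i) < 0 := τ.extendSubtype_not_mem i hi
      rw [sign_eq_one hi]
      rcases hw (σ i) with h | h <;> linarith
  refine ⟨((Pi.basisFun ℝ _).map φ.toLinearEquiv.symm).reindex σ.symm, fun i j => ?_⟩
  have hf : ∀ x, g (φ.toLinearEquiv.symm x) (φ.toLinearEquiv.symm x)
      = QuadraticMap.weightedSumSquares ℝ w x := fun x => by
    have := φ.map_app (φ.toLinearEquiv.symm x)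
    rw [show φ (φ.toLinearEquiv.symm x) = x from φ.toLinearEquiv.apply_symm_apply x] at this
    rw [this]; rfl
  have hq : ∀ x y, g (φ.toLinearEquiv.symm x) (φ.toLinearEquiv.symm y)
      = ∑ i, w i * (x i * y i) := fun x y => by
    have h1 := hf (x + y)
    have h2 := hf (x - y)
    simp only [map_add, map_sub, LinearMap.add_apply, LinearMap.sub_apply,
      QuadraticMap.weightedSumSquares_apply, Pi.add_apply, Pi.sub_apply, smul_eq_mul] at h1 h2
    have h3 : ∑ i, w i * (x i * y i) = (∑ i, w i * ((x i + y i) * (x i + y i))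
        - ∑ i, w i * ((x i - y i) * (x i - y i))) / 4 := by
      rw [← Finset.sum_sub_distrib, Finset.sum_div]
      exact Finset.sum_congr rfl fun i _ => by ring
    rw [h3, ← h1, ← h2, hg (φ.toLinearEquiv.symm y) (φ.toLinearEquiv.symm x)]
    ring
  have h4 := hq (Pi.single (σ i) 1) (Pi.single (σ j) 1)
  simp only [Module.Basis.reindex_apply, Equiv.symm_symm, Module.Basis.map_apply,
    Pi.basisFun_apply]
  rw [h4, ← hσ i]
  simp only [Pi.single_apply, mul_ite, mul_one, mul_zero, Finset.sum_ite_eq', Finset.mem_univ,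
    if_true, σ.injective.eq_iff]
  by_cases hij : i = j
  · subst hij; simp
  · simp [hij, Ne.symm hij]

/-- Index and nondegeneracy are transported by linear isomorphisms. -/
lemma HasIndex.comp_equiv {V' : Type*} [AddCommGroup V'] [Module ℝ V']
    {k : ℕ} {g : LinearMap.BilinForm ℝ V} (h : HasIndex g k) (L : V' ≃ₗ[ℝ] V) :
    HasIndex (g.comp (L : V' →ₗ[ℝ] V) (L : V' →ₗ[ℝ] V)) k := by
  refine ⟨⟨fun x hx => ?_, fun y hy => ?_⟩, ?_⟩
  · refine L.map_eq_zero_iff.1 (h.1.1 _ fun y => ?_)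
    simpa using hx (L.symm y)
  · refine L.map_eq_zero_iff.1 (h.1.2 _ fun x => ?_)
    simpa using hy (L.symm x)
  · rw [← h.2]
    exact QuadraticMap.Equivalent.sigNeg_eq ⟨⟨L, fun x => by simp⟩⟩

/-- A proper nondegenerate subspace has a non-null normal vector. -/
lemma exists_orthogonal_apply_self_ne_zero [FiniteDimensional ℝ V]
    {B : LinearMap.BilinForm ℝ V} (hB : B.Nondegenerate) (hs : ∀ x y, B x y = B y x)
    {T : Submodule ℝ V} (hT : IsCompl T (B.orthogonal T)) (hne : T ≠ ⊤) :
    ∃ x ∈ B.orthogonal T, B x x ≠ 0 := by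
  by_contra! hx
  have hN : ∀ x ∈ B.orthogonal T, ∀ y ∈ B.orthogonal T, B x y = 0 := fun x hx' y hy => by
    have h1 := hx (x + y) (add_mem hx' hy)
    simp only [map_add, LinearMap.add_apply, hx x hx', hx y hy, hs y x] at h1
    linarith
  have hbot : B.orthogonal T = ⊥ := by
    rw [eq_bot_iff]
    intro x hx'
    refine hB.1 x fun y => ?_
    obtain ⟨t, ht, n, hn, rfl⟩ := Submodule.mem_sup.1
      (show y ∈ T ⊔ B.orthogonal T from hT.sup_eq_top ▸ Submodule.mem_top)
    rw [map_add, hN x hx' n hn, hs, (LinearMap.BilinForm.mem_orthogonal_iff.1 hx') t ht, add_zero]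
  exact hne (by simpa [hbot] using hT.sup_eq_top)

end Forms

/-- One half of the law of inertia for Hermitian matrices: a diagonalisation `Aᵀ S A̅ = S'` does not
increase the number of negative signs. If it did, some nonzero combination of the negative
directions of `S'` would have no component along the negative directions of `S`. -/
lemma card_neg_le_of_hermitian_congr {m : ℕ} (S S' : Fin m → ℝ)
    (A : Fin m → Fin m → ℂ)
    (h : ∀ i j, ∑ l, (S l : ℂ) * (A i l * conj (A j l)) = if i = j then (S' i : ℂ) else 0) :
    Fintype.card {i // S' i < 0} ≤ Fintype.card {i // S i < 0} := by
  by_contra! hlt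
  let F : ({i // S' i < 0} → ℂ) →ₗ[ℂ] ({l // S l < 0} → ℂ) :=
    { toFun := fun c l => ∑ i, c i * A i l
      map_add' := fun c d => by
        ext l; simp [add_mul, Finset.sum_add_distrib]
      map_smul' := fun r c => by
        ext l; simp [mul_assoc, Finset.mul_sum] }
  have hker : LinearMap.ker F ≠ ⊥ := LinearMap.ker_ne_bot_of_finrank_lt (by simpa using hlt)
  obtain ⟨c, hc, hc0⟩ := Submodule.exists_mem_ne_zero_of_ne_bot hker
  set z : Fin m → ℂ := fun l => ∑ i, c i * A i l
  have hz : ∀ l, S l < 0 → z l = 0 := fun l hl => congrFun (LinearMap.mem_ker.1 hc) ⟨l, hl⟩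
  have h1 : ∑ l, (S l : ℂ) * (z l * conj (z l)) =
      ∑ i : {i // S' i < 0}, (S' i : ℂ) * (c i * conj (c i)) := by
    have : ∀ l, (S l : ℂ) * (z l * conj (z l))
        = ∑ i : {i // S' i < 0}, ∑ j : {i // S' i < 0},
          c i * conj (c j) * ((S l : ℂ) * (A i l * conj (A j l))) := fun l => by
      simp only [z, map_sum, map_mul]
      rw [Finset.sum_mul_sum, Finset.mul_sum]
      simp only [Finset.mul_sum]
      exact Finset.sum_congr rfl fun i _ => Finset.sum_congr rfl fun j _ => by ring
    simp only [this]
    rw [Finset.sum_comm]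
    refine Finset.sum_congr rfl fun i _ => ?_
    rw [Finset.sum_comm]
    simp only [← Finset.mul_sum, h, mul_ite, mul_zero, Subtype.coe_inj]
    simp; ring
  have h2 : ∑ l, S l * ‖z l‖ ^ 2 = ∑ i : {i // S' i < 0}, S' i * ‖c i‖ ^ 2 := by
    simp only [Complex.mul_conj, Complex.normSq_eq_norm_sq] at h1
    exact_mod_cast h1
  have h3 : 0 ≤ ∑ l, S l * ‖z l‖ ^ 2 := Finset.sum_nonneg fun l _ => by
    by_cases hl : S l < 0
    · simp [hz l hl]
    · exact mul_nonneg (not_lt.1 hl) (by positivity)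
  obtain ⟨i, hi⟩ := Function.ne_iff.1 hc0
  have h4 : ∑ i : {i // S' i < 0}, S' i * ‖c i‖ ^ 2 < 0 := by
    refine Finset.sum_neg' (fun i _ => mul_nonpos_of_nonpos_of_nonneg i.2.le (by positivity))
      ⟨i, Finset.mem_univ _, mul_neg_of_neg_of_pos i.2 ?_⟩
    have := norm_pos_iff.2 hi
    positivity
  linarith

/-! ### Second order expansion of a determinant -/

section Determinant

open Polynomial Matrix Filter Topology

variable {m : ℕ}

/-- The continuous remainder `E` in `det (1 + r M) = 1 + r tr M + r² E(M, r)`. -/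
def detRemainder (M : Matrix (Fin m) (Fin m) ℝ) (r : ℝ) : ℝ :=
  (det (1 + (X : ℝ[X]) • M.map C)).divX.divX.eval r

lemma det_one_add_smul_eq (M : Matrix (Fin m) (Fin m) ℝ) (r : ℝ) :
    det (1 + r • M) = 1 + trace M * r + detRemainder M r * r ^ 2 :=
  det_one_add_smul r M

lemma continuous_coeff_det_one_add_X_smul (n : ℕ) :
    Continuous fun M : Matrix (Fin m) (Fin m) ℝ => (det (1 + (X : ℝ[X]) • M.map C)).coeff n := by
  have hprod : ∀ (s : Finset (Fin m)) (σ : Equiv.Perm (Fin m)) (n : ℕ),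
      Continuous fun M : Matrix (Fin m) (Fin m) ℝ =>
        (∏ i ∈ s, (1 + (X : ℝ[X]) • M.map C) (σ i) i).coeff n := by
    intro s σ
    induction s using Finset.induction_on with
    | empty => intro n; simpa using continuous_const
    | insert a s ha ih =>
      intro n
      simp only [Finset.prod_insert ha, coeff_mul]
      refine continuous_finsetSum _ fun p _ => Continuous.mul ?_ (ih p.2)
      simp only [Matrix.add_apply, Matrix.smul_apply, map_apply, smul_eq_mul, coeff_add]
      refine continuous_const.add ?_
      rcases p.1 with _ | _ | q
      · simpa using continuous_const
      · simp only [coeff_X_mul, coeff_C_zero]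
        fun_prop
      · simpa [coeff_C] using continuous_const
  simp only [det_apply, finsetSum_coeff]
  refine continuous_finsetSum _ fun σ _ => ?_
  simp only [coeff_smul]
  exact (hprod _ σ n).const_smul _

lemma continuous_detRemainder :
    Continuous fun p : Matrix (Fin m) (Fin m) ℝ × ℝ => detRemainder p.1 p.2 := by
  have hdeg : ∀ M : Matrix (Fin m) (Fin m) ℝ,
      (det (1 + (X : ℝ[X]) • M.map C)).divX.divX.natDegree < m + 1 := fun M => by
    have h := natDegree_det_X_add_C_le M (1 : Matrix (Fin m) (Fin m) ℝ)
    rw [add_comm, Matrix.map_one C (map_zero _) (map_one _), Fintype.card_fin] at h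
    rw [natDegree_divX_eq_natDegree_tsub_one, natDegree_divX_eq_natDegree_tsub_one]
    omega
  simp only [detRemainder, eval_eq_sum_range' (hdeg _), coeff_divX]
  refine continuous_finsetSum _ fun i _ => ?_
  exact ((continuous_coeff_det_one_add_X_smul _).comp continuous_fst).mul (continuous_snd.pow _)

/-- The second order coefficient is homogeneous of degree two. -/
lemma detRemainder_smul_zero (M : Matrix (Fin m) (Fin m) ℝ) (f : ℝ) :
    detRemainder (f • M) 0 = f ^ 2 * detRemainder M 0 := by
  have h1 : Continuous fun r => detRemainder (f • M) r :=
    continuous_detRemainder.comp (by fun_prop : Continuous fun r : ℝ => (f • M, r))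
  have h2 : Continuous fun r => f ^ 2 * detRemainder M (r * f) :=
    continuous_const.mul (continuous_detRemainder.comp
      (by fun_prop : Continuous fun r : ℝ => (M, r * f)))
  have h3 : EqOn (fun r => detRemainder (f • M) r) (fun r => f ^ 2 * detRemainder M (r * f))
      {0}ᶜ := fun r hr => by
    have hr : r ≠ 0 := hr
    have e1 := det_one_add_smul_eq (f • M) r
    have e2 := det_one_add_smul_eq M (r * f)
    rw [smul_smul, e2, trace_smul, smul_eq_mul] at e1
    have : r ^ 2 * detRemainder (f • M) r = r ^ 2 * (f ^ 2 * detRemainder M (r * f)) := by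
      linarith
    exact mul_left_cancel₀ (pow_ne_zero 2 hr) this
  have h4 := Continuous.ext_on (dense_compl_singleton (0 : ℝ)) h1 h2 h3
  simpa using congrFun h4 0

variable {Y : Type*} [TopologicalSpace Y] [CompactSpace Y] [MeasurableSpace Y] [BorelSpace Y]

/-- If `tr M₁ = 0`, the sign of the second derivative `∫ √d (tr M₂ + E(M₁, 0))` decides how
`∫ √(d det (1 + t M₁ + t² M₂))` compares with `∫ √d` for small `t ≠ 0`. The sign `s = ±1` treats
both cases at once. -/
lemma eventually_integral_sqrt_det (μ : Measure Y) [IsFiniteMeasure μ] {d : Y → ℝ}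
    (hd : Continuous d) (hpos : ∀ y, 0 < d y) {M₁ M₂ : Y → Matrix (Fin m) (Fin m) ℝ}
    (h₁ : Continuous M₁) (h₂ : Continuous M₂) (htr : ∀ y, trace (M₁ y) = 0) (s : ℝ)
    (hs : 0 < s * ∫ y, Real.sqrt (d y) * (trace (M₂ y) + detRemainder (M₁ y) 0) ∂μ) :
    ∀ᶠ t in 𝓝 (0 : ℝ), (∀ y, 0 < det (1 + t • M₁ y + t ^ 2 • M₂ y)) ∧
      (t ≠ 0 → 0 < s * (∫ y, Real.sqrt (d y * det (1 + t • M₁ y + t ^ 2 • M₂ y)) ∂μ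
        - ∫ y, Real.sqrt (d y) ∂μ)) := by
  set D : ℝ → Y → ℝ := fun t y => det (1 + t • M₁ y + t ^ 2 • M₂ y) with hD
  have hDc : Continuous (Function.uncurry D) := by
    simp only [hD, Function.uncurry_def]
    exact Continuous.matrix_det (by fun_prop)
  set R : ℝ → Y → ℝ := fun t y => trace (M₂ y) + detRemainder (M₁ y + t • M₂ y) t with hR
  have hRc : Continuous (Function.uncurry R) := by
    simp only [hR, Function.uncurry_def]
    refine Continuous.add (by fun_prop) (continuous_detRemainder.comp
      (by fun_prop : Continuous fun p : ℝ × Y => (M₁ p.2 + p.1 • M₂ p.2, p.1)))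
  have hDR : ∀ t y, D t y = 1 + t ^ 2 * R t y := fun t y => by
    have := det_one_add_smul_eq (M₁ y + t • M₂ y) t
    rw [smul_add, smul_smul, ← add_assoc, ← sq, trace_add, trace_smul, htr, smul_eq_mul] at this
    rw [hD, hR]; simp only; rw [this]; ring
  have hD0 : ∀ y, D 0 y = 1 := fun y => by simp [hDR]
  set J : ℝ → Y → ℝ := fun t y =>
    d y * R t y / (Real.sqrt (d y * D t y) + Real.sqrt (d y)) with hJ
  have hJc : Continuous (Function.uncurry J) := by
    simp only [hJ, Function.uncurry_def]
    refine Continuous.div (Continuous.mul (by fun_prop) hRc)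
      (Continuous.add (Continuous.sqrt (Continuous.mul (by fun_prop) hDc)) (by fun_prop)) ?_
    intro p
    have := Real.sqrt_pos.2 (hpos p.2)
    positivity
  have hcont : Continuous fun t => ∫ y, J t y ∂μ := by
    simpa using continuous_parametric_integral_of_continuous (μ := μ) hJc isCompact_univ
  have hJ0 : 0 < s * ∫ y, J 0 y ∂μ := by
    have : ∀ y, J 0 y = (Real.sqrt (d y) * (trace (M₂ y) + detRemainder (M₁ y) 0)) * (1 / 2) := by
      intro y
      have h0 := Real.sqrt_pos.2 (hpos y)
      have h1 := Real.mul_self_sqrt (hpos y).le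
      simp only [hJ, hD0, hR, mul_one, zero_smul, add_zero]
      rw [div_eq_iff (by positivity)]
      nth_rewrite 1 [← h1]
      ring
    simp only [this, integral_mul_const]
    linarith
  have hopen : IsOpen {t : ℝ | ∀ y, 0 < D t y} := by
    have : {t : ℝ | ∀ y, 0 < D t y} = (Prod.fst '' {p : ℝ × Y | D p.1 p.2 ≤ 0})ᶜ := by
      ext t; simp
    rw [this, isOpen_compl_iff]
    exact isClosedMap_fst_of_compactSpace _ (isClosed_le hDc continuous_const)
  filter_upwards [hopen.mem_nhds (by simp [hD0] : (0 : ℝ) ∈ _),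
    (continuous_const.mul hcont).continuousAt.eventually_const_lt hJ0] with t ht hJt
  refine ⟨ht, fun ht0 => ?_⟩
  have hint : ∀ F : Y → ℝ, Continuous F → Integrable F μ := fun F hF =>
    hF.integrable_of_hasCompactSupport (HasCompactSupport.of_compactSpace F)
  have hDt : Continuous (D t) := hDc.comp (by fun_prop : Continuous fun y : Y => (t, y))
  change 0 < s * (∫ y, Real.sqrt (d y * D t y) ∂μ - ∫ y, Real.sqrt (d y) ∂μ)
  rw [← integral_sub (hint (fun y => Real.sqrt (d y * D t y)) (by fun_prop))
    (hint (fun y => Real.sqrt (d y)) (by fun_prop))]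
  have : ∀ y, Real.sqrt (d y * D t y) - Real.sqrt (d y) = t ^ 2 * J t y := fun y => by
    have h0 := Real.sqrt_pos.2 (hpos y)
    have h1 := Real.mul_self_sqrt (hpos y).le
    have h2 := Real.mul_self_sqrt (mul_pos (hpos y) (ht y)).le
    simp only [hJ]
    rw [← mul_div_assoc, eq_div_iff (by positivity)]
    have h3 := hDR t y
    linear_combination h2 - h1 + d y * h3
  rw [integral_congr_ae (Filter.Eventually.of_forall this), integral_const_mul]
  have h0 : 0 < t ^ 2 := by positivity
  rw [mul_left_comm]
  exact mul_pos h0 hJt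

end Determinant

/-! ### The volume of pieces of a manifold -/

section Volume

open Topology

variable {m : ℕ} {M : Type*} [TopologicalSpace M]

lemma isOpen_transition_domain (c c' : OpenPartialHomeomorph M (EuclideanSpace ℝ (Fin m))) :
    IsOpen (c'.target ∩ c'.symm ⁻¹' c.source) :=
  c'.isOpen_inter_preimage_symm c.open_source

lemma measurableSet_chart_image (c : OpenPartialHomeomorph M (EuclideanSpace ℝ (Fin m)))
    {S : Set M} (hS : MeasurableSet[borel M] S) (hSc : S ⊆ c.source) : MeasurableSet (c '' S) := by
  borelize M
  have h := (continuousOn_iff_continuous_domRestrict.1 c.symm.continuousOn).measurable hS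
  have h2 := c.open_target.measurableSet.subtype_image h
  convert h2 using 1
  ext u
  constructor
  · rintro ⟨x, hx, rfl⟩
    exact ⟨⟨c x, c.map_source (hSc hx)⟩, by simpa [c.left_inv (hSc hx)] using hx, rfl⟩
  · rintro ⟨v, hv, rfl⟩
    exact ⟨c.symm v, hv, c.right_inv v.2⟩

variable {E : Type*} [NormedAddCommGroup E] [NormedSpace ℝ E]

lemma sum_chartVolume_le {ι : Type*} [Fintype ι] (B : LinearMap.BilinForm ℝ E) (k : ℕ) (φ : M → E)
    (c : OpenPartialHomeomorph M (EuclideanSpace ℝ (Fin m))) {K : Set M} (hK : K ⊆ c.source)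
    {S : ι → Set M} (hS : ∀ i, MeasurableSet[borel M] (S i)) (hSK : ∀ i, S i ⊆ K)
    (hd : Pairwise fun i j => Disjoint (S i) (S j)) :
    ∑ i, chartVolume m B k φ c (S i) ≤ chartVolume m B k φ c K := by
  unfold chartVolume
  rw [← tsum_fintype (L := .unconditional _), ← lintegral_iUnion (s := fun i => c '' S i)
    (fun i => measurableSet_chart_image c (hS i) ((hSK i).trans hK))
    (fun i j hij => ?_)]
  · exact lintegral_mono_set (iUnion_subset fun i => image_mono (hSK i))
  · exact disjoint_image_image fun x hx y hy hxy => (hd hij).ne_of_mem hx hy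
      (c.injOn (hK (hSK i hx)) (hK (hSK j hy)) hxy)

variable [ChartedSpace (EuclideanSpace ℝ (Fin m)) M]

lemma contDiffOn_comp_symm {φ : M → E} (hφ : ContMDiff (𝓡 m) 𝓘(ℝ, E) ∞ φ)
    {c : OpenPartialHomeomorph M (EuclideanSpace ℝ (Fin m))}
    (hc : c ∈ IsManifold.maximalAtlas (𝓡 m) ∞ M) : ContDiffOn ℝ ∞ (φ ∘ c.symm) c.target :=
  contMDiffOn_iff_contDiffOn.1 (hφ.comp_contMDiffOn (contMDiffOn_symm_of_mem_maximalAtlas hc))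

lemma contDiffOn_transition {c c' : OpenPartialHomeomorph M (EuclideanSpace ℝ (Fin m))}
    (hc : c ∈ IsManifold.maximalAtlas (𝓡 m) ∞ M) (hc' : c' ∈ IsManifold.maximalAtlas (𝓡 m) ∞ M) :
    ContDiffOn ℝ ∞ (c ∘ c'.symm) (c'.target ∩ c'.symm ⁻¹' c.source) :=
  contMDiffOn_iff_contDiffOn.1 ((contMDiffOn_of_mem_maximalAtlas hc).comp
    ((contMDiffOn_symm_of_mem_maximalAtlas hc').mono inter_subset_left) fun _ h => h.2)

lemma differentiableAt_of_contDiffOn {V : Type*} [NormedAddCommGroup V] [NormedSpace ℝ V]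
    {f : V → E} {U : Set V} (hf : ContDiffOn ℝ ∞ f U) (hU : IsOpen U) {u : V} (hu : u ∈ U) :
    DifferentiableAt ℝ f u :=
  (hf.contDiffAt (hU.mem_nhds hu)).differentiableAt (by simp)

/-- The chain rule for the change from the chart `c` to the chart `c'`. -/
lemma fderiv_comp_symm_transition {φ : M → E} (hφ : ContMDiff (𝓡 m) 𝓘(ℝ, E) ∞ φ)
    {c c' : OpenPartialHomeomorph M (EuclideanSpace ℝ (Fin m))}
    (hc : c ∈ IsManifold.maximalAtlas (𝓡 m) ∞ M) (hc' : c' ∈ IsManifold.maximalAtlas (𝓡 m) ∞ M)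
    {u : EuclideanSpace ℝ (Fin m)} (hu : u ∈ c'.target ∩ c'.symm ⁻¹' c.source) :
    fderiv ℝ (φ ∘ c'.symm) u
      = (fderiv ℝ (φ ∘ c.symm) (c (c'.symm u))).comp (fderiv ℝ (c ∘ c'.symm) u) := by
  have h1 : φ ∘ c'.symm =ᶠ[𝓝 u] (φ ∘ c.symm) ∘ (c ∘ c'.symm) := by
    filter_upwards [(isOpen_transition_domain c c').mem_nhds hu] with v hv
    simp [c.left_inv hv.2]
  rw [h1.fderiv_eq]
  exact fderiv_comp u (differentiableAt_of_contDiffOn (contDiffOn_comp_symm hφ hc) c.open_target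
    (c.map_source hu.2)) (differentiableAt_of_contDiffOn (contDiffOn_transition hc hc')
      (isOpen_transition_domain c c') hu)

lemma det_coordinateMetric_transition (B : LinearMap.BilinForm ℝ E) {φ : M → E}
    (hφ : ContMDiff (𝓡 m) 𝓘(ℝ, E) ∞ φ)
    {c c' : OpenPartialHomeomorph M (EuclideanSpace ℝ (Fin m))}
    (hc : c ∈ IsManifold.maximalAtlas (𝓡 m) ∞ M) (hc' : c' ∈ IsManifold.maximalAtlas (𝓡 m) ∞ M)
    {u : EuclideanSpace ℝ (Fin m)} (hu : u ∈ c'.target ∩ c'.symm ⁻¹' c.source) :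
    (coordinateMetric m B φ c' u).det = (fderiv ℝ (c ∘ c'.symm) u).det ^ 2 *
      (coordinateMetric m B φ c (c (c'.symm u))).det := by
  set b := (EuclideanSpace.basisFun (Fin m) ℝ).toBasis with hb
  have hbi : ∀ i, b i = EuclideanSpace.single i 1 := fun i => by simp [hb]
  set T := fderiv ℝ (c ∘ c'.symm) u with hT
  set P := LinearMap.toMatrix b b (T : EuclideanSpace ℝ (Fin m) →ₗ[ℝ] EuclideanSpace ℝ (Fin m))
  have hP : P.det = T.det := LinearMap.det_toMatrix b _
  have hmul : coordinateMetric m B φ c' u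
      = P.transpose * coordinateMetric m B φ c (c (c'.symm u)) * P := by
    ext i j
    set D := fderiv ℝ (φ ∘ c.symm) (c (c'.symm u)) with hD
    have h1 := apply_eq_sum_repr
      (B.comp (D : EuclideanSpace ℝ (Fin m) →ₗ[ℝ] E) (D : EuclideanSpace ℝ (Fin m) →ₗ[ℝ] E)) b
      (T (b i)) (T (b j))
    simp only [LinearMap.BilinForm.comp_apply, ContinuousLinearMap.coe_coe, hbi] at h1
    simp only [coordinateMetric, Matrix.of_apply, fderiv_comp_symm_transition hφ hc hc' hu,
      ContinuousLinearMap.comp_apply, ← hT, ← hD, h1, Matrix.mul_apply, Matrix.transpose_apply,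
      P, LinearMap.toMatrix_apply, ContinuousLinearMap.coe_coe, hbi, Finset.sum_mul]
    rw [Finset.sum_comm]
    exact Finset.sum_congr rfl fun x _ => Finset.sum_congr rfl fun y _ => by ring
  rw [hmul, Matrix.det_mul, Matrix.det_mul, Matrix.det_transpose, hP]
  ring

/-- The volume of a piece does not depend on the chart: the change of variables formula. -/
lemma chartVolume_eq (B : LinearMap.BilinForm ℝ E) (k : ℕ) {φ : M → E}
    (hφ : ContMDiff (𝓡 m) 𝓘(ℝ, E) ∞ φ)
    {c c' : OpenPartialHomeomorph M (EuclideanSpace ℝ (Fin m))}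
    (hc : c ∈ IsManifold.maximalAtlas (𝓡 m) ∞ M) (hc' : c' ∈ IsManifold.maximalAtlas (𝓡 m) ∞ M)
    {S : Set M} (hS : MeasurableSet[borel M] S) (hSc : S ⊆ c.source) (hSc' : S ⊆ c'.source) :
    chartVolume m B k φ c S = chartVolume m B k φ c' S := by
  have hmem : ∀ u ∈ c' '' S, u ∈ c'.target ∩ c'.symm ⁻¹' c.source := by
    rintro _ ⟨x, hx, rfl⟩
    exact ⟨c'.map_source (hSc' hx), by simpa [c'.left_inv (hSc' hx)] using hSc hx⟩
  have himg : c '' S = (c ∘ c'.symm) '' (c' '' S) := by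
    rw [image_image]
    exact image_congr fun x hx => by simp [c'.left_inv (hSc' hx)]
  have hm := measurableSet_chart_image c' hS hSc'
  unfold chartVolume
  rw [himg, lintegral_image_eq_lintegral_abs_det_fderiv_mul volume hm
    (f' := fun u => fderiv ℝ (c ∘ c'.symm) u) ?_ ?_]
  · refine setLIntegral_congr_fun hm fun u hu => ?_
    simp only [det_coordinateMetric_transition B hφ hc hc' (hmem u hu), Function.comp_apply]
    rw [← ENNReal.ofReal_mul (abs_nonneg _), mul_left_comm, Real.sqrt_mul (sq_nonneg _),
      Real.sqrt_sq_eq_abs]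
  · exact fun u hu => (differentiableAt_of_contDiffOn (contDiffOn_transition hc hc')
      (isOpen_transition_domain c c') (hmem u hu)).hasFDerivAt.hasFDerivWithinAt
  · intro u hu v hv huv
    have h1 := c.injOn (hmem u hu).2 (hmem v hv).2 huv
    exact c'.symm.injOn (hmem u hu).1 (hmem v hv).1 h1

/-- The supremum defining `volumeOn` is additive along a piece `K` inside a chart. -/
lemma volumeOn_eq_chartVolume_add (B : LinearMap.BilinForm ℝ E) (k : ℕ) {φ : M → E}
    (hφ : ContMDiff (𝓡 m) 𝓘(ℝ, E) ∞ φ)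
    {c : OpenPartialHomeomorph M (EuclideanSpace ℝ (Fin m))}
    (hc : c ∈ IsManifold.maximalAtlas (𝓡 m) ∞ M) {K A : Set M} (hK : MeasurableSet[borel M] K)
    (hKc : K ⊆ c.source) (hKA : K ⊆ A) (hfin : chartVolume m B k φ c K ≠ ⊤) :
    volumeOn m B k φ A = chartVolume m B k φ c K + volumeOn m B k φ (A \ K) := by
  have hle : ∀ (A : Set M) (r : ℕ) (e : Fin r → OpenPartialHomeomorph M (EuclideanSpace ℝ (Fin m)))
      (S : Fin r → Set M), (∀ i, e i ∈ IsManifold.maximalAtlas (𝓡 m) ∞ M ∧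
        MeasurableSet[borel M] (S i) ∧ S i ⊆ A ∩ (e i).source) →
      (Pairwise fun i j => Disjoint (S i) (S j)) →
      ∑ i, chartVolume m B k φ (e i) (S i) ≤ volumeOn m B k φ A := fun A r e S h hd =>
    le_iSup_of_le r <| le_iSup_of_le e <| le_iSup_of_le S <| le_iSup_of_le h <|
      le_iSup_of_le hd le_rfl
  refine le_antisymm ?_ ?_
  · refine iSup_le fun r => iSup_le fun e => iSup_le fun S => iSup_le fun h => iSup_le fun hd => ?_
    borelize M
    calc ∑ i, chartVolume m B k φ (e i) (S i)
        ≤ ∑ i, (chartVolume m B k φ c (S i ∩ K) + chartVolume m B k φ (e i) (S i \ K)) := by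
          refine Finset.sum_le_sum fun i _ => ?_
          rw [chartVolume_eq B k hφ hc (h i).1 ((h i).2.1.inter hK)
            (inter_subset_right.trans hKc) (inter_subset_left.trans ((h i).2.2.trans
              inter_subset_right))]
          unfold chartVolume
          refine le_trans (le_of_eq ?_) (lintegral_union_le _ _ _)
          rw [← image_union, inter_union_sdiff]
      _ = ∑ i, chartVolume m B k φ c (S i ∩ K) + ∑ i, chartVolume m B k φ (e i) (S i \ K) :=
          Finset.sum_add_distrib
      _ ≤ _ := by
          refine add_le_add (sum_chartVolume_le B k φ c hKc (fun i => (h i).2.1.inter hK)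
            (fun i => inter_subset_right) fun i j hij =>
              (hd hij).mono inter_subset_left inter_subset_left) (hle _ r e _ (fun i => ⟨(h i).1,
                (h i).2.1.diff hK, fun x hx => ⟨⟨((h i).2.2 hx.1).1, hx.2⟩, ((h i).2.2 hx.1).2⟩⟩)
                  fun i j hij => (hd hij).mono sdiff_subset sdiff_subset)
  · have hstep : ∀ (r : ℕ) (e : Fin r → OpenPartialHomeomorph M (EuclideanSpace ℝ (Fin m)))
        (S : Fin r → Set M), (∀ i, e i ∈ IsManifold.maximalAtlas (𝓡 m) ∞ M ∧
          MeasurableSet[borel M] (S i) ∧ S i ⊆ (A \ K) ∩ (e i).source) →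
        (Pairwise fun i j => Disjoint (S i) (S j)) →
        chartVolume m B k φ c K + ∑ i, chartVolume m B k φ (e i) (S i) ≤ volumeOn m B k φ A := by
      intro r e S h hd
      have := hle A (r + 1) (Fin.cons c e) (Fin.cons K S) (fun i => ?_) (fun i j hij => ?_)
      · simpa [Fin.sum_univ_succ] using this
      · refine Fin.cases ?_ (fun i => ?_) i
        · exact ⟨hc, hK, subset_inter hKA hKc⟩
        · exact ⟨(h i).1, (h i).2.1, fun x hx => ⟨((h i).2.2 hx).1.1, ((h i).2.2 hx).2⟩⟩
      · have hKS : ∀ i, Disjoint K (S i) := fun i =>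
          disjoint_left.2 fun x hx hx' => ((h i).2.2 hx').1.2 hx
        induction i using Fin.cases with
        | zero => induction j using Fin.cases with
          | zero => exact absurd rfl hij
          | succ j => exact hKS j
        | succ i => induction j using Fin.cases with
          | zero => exact (hKS i).symm
          | succ j => exact hd (show i ≠ j from fun hh => hij (congrArg Fin.succ hh))
    have hKle : chartVolume m B k φ c K ≤ volumeOn m B k φ A := by
      simpa using hstep 0 Fin.elim0 Fin.elim0 (fun i => i.elim0) fun i => i.elim0
    have : volumeOn m B k φ (A \ K) ≤ volumeOn m B k φ A - chartVolume m B k φ c K :=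
      iSup_le fun r => iSup_le fun e => iSup_le fun S => iSup_le fun h => iSup_le fun hd =>
        ENNReal.le_sub_of_add_le_left hfin (hstep r e S h hd)
    calc _ ≤ chartVolume m B k φ c K + (volumeOn m B k φ A - chartVolume m B k φ c K) := by gcongr
      _ = _ := add_tsub_cancel_of_le hKle

/-- Maps that agree off a closed set induce the same volume off that set. -/
lemma volumeOn_congr (B : LinearMap.BilinForm ℝ E) (k : ℕ) {φ φ' : M → E} {K A : Set M}
    (hK : IsClosed K) (h : ∀ p ∉ K, φ p = φ' p) :
    volumeOn m B k φ (A \ K) = volumeOn m B k φ' (A \ K) := by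
  unfold volumeOn
  refine iSup_congr fun r => iSup_congr fun e => iSup_congr fun S => iSup_congr fun hS =>
    iSup_congr fun hd => Finset.sum_congr rfl fun i _ => ?_
  obtain ⟨-, h2, h3⟩ := hS i
  unfold chartVolume
  refine setLIntegral_congr_fun
    (measurableSet_chart_image _ h2 (h3.trans inter_subset_right)) ?_
  rintro _ ⟨x, hx, rfl⟩
  have hev : φ ∘ (e i).symm =ᶠ[𝓝 (e i x)] φ' ∘ (e i).symm := by
    have hopen := (e i).isOpen_inter_preimage_symm hK.isOpen_compl
    filter_upwards [hopen.mem_nhds ⟨(e i).map_source (h3 hx).2, by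
      simpa [(e i).left_inv (h3 hx).2] using (h3 hx).1.2⟩] with v hv
    exact h _ hv.2
  simp only [coordinateMetric, hev.fderiv_eq]

lemma volumeOn_empty (B : LinearMap.BilinForm ℝ E) (k : ℕ) (φ : M → E) :
    volumeOn m B k φ ∅ = 0 := by
  refine le_antisymm (iSup_le fun r => iSup_le fun e => iSup_le fun S => iSup_le fun h =>
    iSup_le fun hd => ?_) zero_le
  refine (Finset.sum_eq_zero fun i _ => ?_).le
  have : S i = ∅ := subset_empty_iff.1 fun x hx => ((h i).2.2 hx).1
  simp [chartVolume, this]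

end Volume

/-! ### Tangent planes and normal fields in charts -/

section Charts

open Topology

variable {m : ℕ} {M : Type*} [TopologicalSpace M] [ChartedSpace (EuclideanSpace ℝ (Fin m)) M]
  {E : Type*} [NormedAddCommGroup E] [NormedSpace ℝ E]

instance finiteDimensional_tangentSpace (p : M) : FiniteDimensional ℝ (TangentSpace (𝓡 m) p) :=
  inferInstanceAs (FiniteDimensional ℝ (EuclideanSpace ℝ (Fin m)))

lemma finrank_tangentSpace (p : M) : Module.finrank ℝ (TangentSpace (𝓡 m) p) = m :=
  (finrank_euclideanSpace_fin : Module.finrank ℝ (EuclideanSpace ℝ (Fin m)) = m)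

/-- The form `v, w ↦ B (D v) (D w)` pulled back by a continuous linear map; with `D` the derivative
of a parametrisation it is the induced metric in coordinates. -/
def pullbackForm (B : LinearMap.BilinForm ℝ E) (D : EuclideanSpace ℝ (Fin m) →L[ℝ] E) :
    LinearMap.BilinForm ℝ (EuclideanSpace ℝ (Fin m)) :=
  B.comp (D : EuclideanSpace ℝ (Fin m) →ₗ[ℝ] E) (D : EuclideanSpace ℝ (Fin m) →ₗ[ℝ] E)

@[simp] lemma pullbackForm_apply (B : LinearMap.BilinForm ℝ E)
    (D : EuclideanSpace ℝ (Fin m) →L[ℝ] E) (v w : EuclideanSpace ℝ (Fin m)) :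
    pullbackForm B D v w = B (D v) (D w) := rfl

lemma inducedMetric_apply (B : LinearMap.BilinForm ℝ E) (φ : M → E) (p : M)
    (v w : TangentSpace (𝓡 m) p) :
    inducedMetric m B φ p v w = B (differential m φ p v) (differential m φ p w) := rfl

/-- The identification of `ℝ^m` with the tangent space by the differential of a chart. -/
lemma exists_chart_equiv [IsManifold (𝓡 m) ∞ M]
    {c : OpenPartialHomeomorph M (EuclideanSpace ℝ (Fin m))}
    (hc : c ∈ IsManifold.maximalAtlas (𝓡 m) ∞ M) {u : EuclideanSpace ℝ (Fin m)}
    (hu : u ∈ c.target) :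
    ∃ L : EuclideanSpace ℝ (Fin m) ≃ₗ[ℝ] TangentSpace (𝓡 m) (c.symm u), ∀ φ : M → E,
      MDifferentiableAt (𝓡 m) 𝓘(ℝ, E) φ (c.symm u) → ∀ v,
        differential m φ (c.symm u) (L v) = fderiv ℝ (φ ∘ c.symm) u v := by
  have he : c.symm.MDifferentiable (𝓡 m) (𝓡 m) :=
    ⟨(contMDiffOn_symm_of_mem_maximalAtlas hc).mdifferentiableOn (by simp),
      (contMDiffOn_of_mem_maximalAtlas hc).mdifferentiableOn (by simp)⟩
  refine ⟨(he.mfderiv hu).toLinearEquiv, fun φ hφ v => ?_⟩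
  rw [← mfderiv_eq_fderiv, mfderiv_comp u hφ (he.mdifferentiableAt hu)]
  rfl

lemma mdifferentiableAt_of_contMDiff {φ : M → E} (hφ : ContMDiff (𝓡 m) 𝓘(ℝ, E) ∞ φ) (p : M) :
    MDifferentiableAt (𝓡 m) 𝓘(ℝ, E) φ p := hφ.mdifferentiable (by simp) p

/-- The induced metric at `c⁻¹(u)` has index `k` exactly when its coordinate expression does. -/
lemma hasIndex_inducedMetric_iff [IsManifold (𝓡 m) ∞ M] (B : LinearMap.BilinForm ℝ E) {k : ℕ}
    {φ : M → E} (hφ : ContMDiff (𝓡 m) 𝓘(ℝ, E) ∞ φ)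
    {c : OpenPartialHomeomorph M (EuclideanSpace ℝ (Fin m))}
    (hc : c ∈ IsManifold.maximalAtlas (𝓡 m) ∞ M) {u : EuclideanSpace ℝ (Fin m)}
    (hu : u ∈ c.target) :
    HasIndex (inducedMetric m B φ (c.symm u)) k ↔
      HasIndex (pullbackForm B (fderiv ℝ (φ ∘ c.symm) u)) k := by
  obtain ⟨L, hL⟩ := exists_chart_equiv (E := E) hc hu
  have hL' := hL φ (mdifferentiableAt_of_contMDiff hφ _)
  constructor
  · intro h
    convert h.comp_equiv L using 1
    ext v w : 2
    simp [inducedMetric_apply, hL']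
  · intro h
    convert h.comp_equiv L.symm using 1
    ext v w : 2
    simp [inducedMetric_apply, ← hL']

lemma mem_normalSpace_iff (B : LinearMap.BilinForm ℝ E) (φ : M → E) (p : M) (x : E) :
    x ∈ normalSpace m B φ p ↔ ∀ v, B (differential m φ p v) x = 0 := by
  simp only [normalSpace, tangentPlane, LinearMap.BilinForm.mem_orthogonal_iff,
    LinearMap.mem_range, forall_exists_index, forall_apply_eq_imp_iff]

lemma mem_normalSpace_symm_iff [IsManifold (𝓡 m) ∞ M] (B : LinearMap.BilinForm ℝ E) {φ : M → E}
    (hφ : ContMDiff (𝓡 m) 𝓘(ℝ, E) ∞ φ)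
    {c : OpenPartialHomeomorph M (EuclideanSpace ℝ (Fin m))}
    (hc : c ∈ IsManifold.maximalAtlas (𝓡 m) ∞ M) {u : EuclideanSpace ℝ (Fin m)}
    (hu : u ∈ c.target) (x : E) :
    x ∈ normalSpace m B φ (c.symm u) ↔ ∀ v, B (fderiv ℝ (φ ∘ c.symm) u v) x = 0 := by
  obtain ⟨L, hL⟩ := exists_chart_equiv (E := E) hc hu
  have hL' := hL φ (mdifferentiableAt_of_contMDiff hφ _)
  rw [mem_normalSpace_iff]
  simp only [← hL']
  exact ⟨fun h v => h _, fun h v => by simpa using h (L.symm v)⟩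

lemma isCompl_normalSpace [FiniteDimensional ℝ E] {B : LinearMap.BilinForm ℝ E}
    (hs : ∀ x y, B x y = B y x) {φ : M → E} {p : M}
    (h : (inducedMetric m B φ p).Nondegenerate) :
    IsCompl (tangentPlane m φ p) (normalSpace m B φ p) := by
  have hrefl : B.IsRefl := fun x y hxy => by rw [hs]; exact hxy
  refine (LinearMap.BilinForm.isCompl_orthogonal_iff_disjoint hrefl).2 ?_
  rw [Submodule.disjoint_def]
  rintro _ ⟨v, rfl⟩ hv
  have hv' := (mem_normalSpace_iff B φ p _).1 hv
  rw [h.2 v fun w => hv' w, map_zero]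

lemma differential_eq_fderiv_extChartAt {φ : M → E} {p : M}
    (hφ : MDifferentiableAt (𝓡 m) 𝓘(ℝ, E) φ p) (v : EuclideanSpace ℝ (Fin m)) :
    differential m φ p v
      = fderiv ℝ (φ ∘ (extChartAt (𝓡 m) p).symm) (extChartAt (𝓡 m) p p) v := by
  have h : (mfderiv (𝓡 m) 𝓘(ℝ, E) φ p : EuclideanSpace ℝ (Fin m) →L[ℝ] E)
      = fderivWithin ℝ (writtenInExtChartAt (𝓡 m) 𝓘(ℝ, E) p φ) (range (𝓡 m))
        (extChartAt (𝓡 m) p p) := hφ.mfderiv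
  rw [modelWithCornersSelf_coe, range_id, fderivWithin_univ] at h
  exact DFunLike.congr_fun h v

/-- Pairing with a normal vector does not see the normal projection. -/
lemma apply_normalProjection [FiniteDimensional ℝ E] {B : LinearMap.BilinForm ℝ E}
    (hs : ∀ x y, B x y = B y x) {φ : M → E} {p : M}
    (h : (inducedMetric m B φ p).Nondegenerate) {x : E} (hx : x ∈ normalSpace m B φ p) (y : E) :
    B (normalProjection m B φ p y) x = B y x := by
  have hc := (isCompl_normalSpace hs h).symm
  rw [normalProjection, dif_pos hc]
  have hmem : y - (normalSpace m B φ p).projection (tangentPlane m φ p) hc y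
      ∈ tangentPlane m φ p := Submodule.sub_projection_mem hc y
  have : B (y - (normalSpace m B φ p).projection (tangentPlane m φ p) hc y) x = 0 :=
    (LinearMap.BilinForm.mem_orthogonal_iff.1 hx) _ hmem
  rw [map_sub, LinearMap.sub_apply, sub_eq_zero] at this
  exact this.symm

lemma hasFDerivAt_bilin [FiniteDimensional ℝ E] (B : LinearMap.BilinForm ℝ E)
    {V : Type*} [NormedAddCommGroup V] [NormedSpace ℝ V] {f g : V → E} {f' g' : V →L[ℝ] E} {u : V}
    (hf : HasFDerivAt f f' u) (hg : HasFDerivAt g g' u) (v : V) :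
    ∃ T : V →L[ℝ] ℝ, HasFDerivAt (fun w => B (f w) (g w)) T u ∧
      T v = B (f' v) (g u) + B (f u) (g' v) := by
  refine ⟨_, B.toContinuousBilinearMap.hasFDerivAt_of_bilinear hf hg, ?_⟩
  simp [add_comm]

/-- Differentiating `B (dφ v) ξ = 0`: on a minimal submanifold `∑ ε_j ⟨dφ e_j, dξ e_j⟩ = 0` for
every normal field `ξ`. Only first derivatives occur, so that this form of minimality can be read in
any chart. -/
lemma IsMinimal.sum_sign_mul_eq_zero [FiniteDimensional ℝ E] [IsManifold (𝓡 m) ∞ M]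
    {B : LinearMap.BilinForm ℝ E} (hs : ∀ x y, B x y = B y x) {k : ℕ} {φ : M → E}
    (hφ : IsIndefiniteSubmanifold m B k φ) (hmin : IsMinimal m B k φ) {p : M} {ξ : M → E}
    (hξ : MDifferentiableAt (𝓡 m) 𝓘(ℝ, E) ξ p) (hn : ∀ᶠ q in 𝓝 p, ξ q ∈ normalSpace m B φ q)
    {e : Module.Basis (Fin m) ℝ (TangentSpace (𝓡 m) p)}
    (he : IsLorentzBasis (inducedMetric m B φ p) k e) :
    ∑ j, sign k j * B (differential m φ p (e j)) (differential m ξ p (e j)) = 0 := by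
  set c := chartAt (EuclideanSpace ℝ (Fin m)) p
  have hc : c ∈ IsManifold.maximalAtlas (𝓡 m) ∞ M := IsManifold.chart_mem_maximalAtlas p
  have hp : p ∈ c.source := mem_chart_source _ p
  have hut : c p ∈ c.target := c.map_source hp
  set ψ := φ ∘ c.symm
  have hψ : ContDiffOn ℝ ∞ ψ c.target := contDiffOn_comp_symm hφ.1 hc
  have hψ2 : HasFDerivAt (fderiv ℝ ψ) (fderiv ℝ (fderiv ℝ ψ) (c p)) (c p) :=
    (((hψ.contDiffAt (c.open_target.mem_nhds hut)).fderiv_right (m := ∞) le_rfl).differentiableAt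
      (by simp)).hasFDerivAt
  have hX : HasFDerivAt (ξ ∘ c.symm) (fderiv ℝ (ξ ∘ c.symm) (c p)) (c p) := by
    refine DifferentiableAt.hasFDerivAt ?_
    rw [← mdifferentiableAt_iff_differentiableAt]
    have h1 : MDifferentiableAt (𝓡 m) 𝓘(ℝ, E) ξ (c.symm (c p)) := by rwa [c.left_inv hp]
    exact h1.comp _ ((contMDiffAt_symm_of_mem_maximalAtlas hc hut).mdifferentiableAt (by simp))
  have hXp : (ξ ∘ c.symm) (c p) = ξ p := by simp [c.left_inv hp]
  have hdφ : ∀ v : EuclideanSpace ℝ (Fin m), differential m φ p v = fderiv ℝ ψ (c p) v := fun v =>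
    differential_eq_fderiv_extChartAt (mdifferentiableAt_of_contMDiff hφ.1 p) v
  have hdξ : ∀ v : EuclideanSpace ℝ (Fin m),
      differential m ξ p v = fderiv ℝ (ξ ∘ c.symm) (c p) v := fun v =>
    differential_eq_fderiv_extChartAt hξ v
  have key : ∀ v : EuclideanSpace ℝ (Fin m), B (differential m φ p v) (differential m ξ p v)
      = - B (fderiv ℝ (fderiv ℝ ψ) (c p) v v) (ξ p) := fun v => by
    obtain ⟨T, hT, hTv⟩ := hasFDerivAt_bilin B (hψ2.clm_apply (hasFDerivAt_const v (c p))) hX v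
    have hzero : (fun w => B (fderiv ℝ ψ w v) ((ξ ∘ c.symm) w)) =ᶠ[𝓝 (c p)] fun _ => 0 := by
      have h1 : Filter.Tendsto c.symm (𝓝 (c p)) (𝓝 p) := by
        simpa [c.left_inv hp] using (c.continuousAt_symm hut).tendsto
      filter_upwards [h1.eventually hn, c.open_target.mem_nhds hut] with w hw hwt
      exact (mem_normalSpace_symm_iff B hφ.1 hc hwt _).1 hw v
    have hT0 : T = 0 := hT.unique ((hasFDerivAt_const 0 (c p)).congr_of_eventuallyEq hzero)
    rw [hT0, hXp] at hTv
    rw [hdφ, hdξ]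
    simp at hTv
    linarith
  have hnp : ξ p ∈ normalSpace m B φ p := hn.self_of_nhds
  have hH := congrArg (fun y => B y (ξ p)) (hmin p e he)
  simp only [meanCurvature, secondFundamentalForm, map_sum, LinearMap.sum_apply, map_smul,
    LinearMap.smul_apply, smul_eq_mul, map_zero, LinearMap.zero_apply,
    apply_normalProjection hs (hφ.2 p).1 hnp] at hH
  have hkey : ∀ j, sign k j * B (differential m φ p (e j)) (differential m ξ p (e j)) = -(sign k j *
      B (fderiv ℝ (fderiv ℝ (φ ∘ (extChartAt (𝓡 m) p).symm)) (extChartAt (𝓡 m) p p) (e j) (e j))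
        (ξ p)) := fun j => by
    rw [← mul_neg]; exact congrArg _ (key (e j))
  rw [Finset.sum_congr rfl fun j _ => hkey j, Finset.sum_neg_distrib, hH, neg_zero]

end Charts

/-! ### Gram matrices of the varied maps -/

section Gram

open Matrix

variable {m : ℕ} {E : Type*} [NormedAddCommGroup E] [NormedSpace ℝ E]

/-- The matrix of `pullbackForm B D` in the standard basis. -/
def gramMatrix (B : LinearMap.BilinForm ℝ E) (D : EuclideanSpace ℝ (Fin m) →L[ℝ] E) :
    Matrix (Fin m) (Fin m) ℝ :=
  Matrix.of fun i j => B (D (EuclideanSpace.single i 1)) (D (EuclideanSpace.single j 1))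

/-- The polarisation of `gramMatrix`, the first order term of `gramMatrix B (D + t • D')`. -/
def crossMatrix (B : LinearMap.BilinForm ℝ E) (D D' : EuclideanSpace ℝ (Fin m) →L[ℝ] E) :
    Matrix (Fin m) (Fin m) ℝ :=
  Matrix.of fun i j => B (D (EuclideanSpace.single i 1)) (D' (EuclideanSpace.single j 1)) +
    B (D' (EuclideanSpace.single i 1)) (D (EuclideanSpace.single j 1))

/-- The rank one matrix `ℓ_i ℓ_j` of the square of a linear functional. -/
def squareMatrix (l : EuclideanSpace ℝ (Fin m) →L[ℝ] ℝ) : Matrix (Fin m) (Fin m) ℝ :=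
  Matrix.of fun i j => l (EuclideanSpace.single i 1) * l (EuclideanSpace.single j 1)

/-- The derivative `f dξ + df ξ` of the product `f ξ` of a function and a vector field. -/
def productDeriv (D' : EuclideanSpace ℝ (Fin m) →L[ℝ] E) (x : E) (f : ℝ)
    (df : EuclideanSpace ℝ (Fin m) →L[ℝ] ℝ) : EuclideanSpace ℝ (Fin m) →L[ℝ] E :=
  f • D' + df.smulRight x

lemma gramMatrix_add_smul_productDeriv {B : LinearMap.BilinForm ℝ E} (hs : ∀ x y, B x y = B y x)
    {D D' : EuclideanSpace ℝ (Fin m) →L[ℝ] E} {x : E} (hx : ∀ v, B (D v) x = 0) (t f : ℝ)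
    (df : EuclideanSpace ℝ (Fin m) →L[ℝ] ℝ) :
    gramMatrix B (D + t • productDeriv D' x f df) = gramMatrix B D + t • (f • crossMatrix B D D')
      + t ^ 2 • gramMatrix B (productDeriv D' x f df) := by
  have hx' : ∀ v, B x (D v) = 0 := fun v => by rw [hs, hx]
  ext i j
  simp only [gramMatrix, crossMatrix, productDeriv, Matrix.of_apply, Matrix.add_apply,
    Matrix.smul_apply, _root_.add_apply, _root_.smul_apply,
    ContinuousLinearMap.smulRight_apply, map_add, map_smul, LinearMap.add_apply,
    LinearMap.smul_apply, smul_eq_mul, hx, hx']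
  ring

/-- With the two oscillating factors `η cos (λ ℓ)` and `η sin (λ ℓ)` the second order terms add up
to a term without oscillation: `cos² + sin² = 1` removes all cross terms. -/
lemma gramMatrix_cos_add_sin (B : LinearMap.BilinForm ℝ E)
    (D' : EuclideanSpace ℝ (Fin m) →L[ℝ] E) (x : E) (η r a : ℝ)
    (dη l : EuclideanSpace ℝ (Fin m) →L[ℝ] ℝ) :
    gramMatrix B (productDeriv D' x (η * Real.cos a) (Real.cos a • dη - (r * η * Real.sin a) • l))
      + gramMatrix B
        (productDeriv D' x (η * Real.sin a) (Real.sin a • dη + (r * η * Real.cos a) • l))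
      = gramMatrix B (productDeriv D' x η dη) + (r ^ 2 * (η ^ 2 * B x x)) • squareMatrix l := by
  ext i j
  simp only [gramMatrix, squareMatrix, productDeriv, Matrix.of_apply, Matrix.add_apply,
    Matrix.smul_apply, _root_.add_apply, _root_.smul_apply,
    _root_.sub_apply,
    ContinuousLinearMap.smulRight_apply, map_add, map_smul, LinearMap.add_apply,
    LinearMap.smul_apply, smul_eq_mul]
  set p := D' (EuclideanSpace.single i 1)
  set q := D' (EuclideanSpace.single j 1)
  set di := dη (EuclideanSpace.single i 1)
  set dj := dη (EuclideanSpace.single j 1)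
  set li := l (EuclideanSpace.single i 1)
  set lj := l (EuclideanSpace.single j 1)
  linear_combination (η * η * B p q + η * dj * B p x + di * η * B x q + di * dj * B x x
    + r ^ 2 * η ^ 2 * B x x * li * lj) * Real.sin_sq_add_cos_sq a

/-- The matrix whose columns are the vectors of a basis. -/
def columns (e : Module.Basis (Fin m) ℝ (EuclideanSpace ℝ (Fin m))) : Matrix (Fin m) (Fin m) ℝ :=
  Matrix.of fun i j => e j i

lemma columns_transpose_mul_mul (F : LinearMap.BilinForm ℝ (EuclideanSpace ℝ (Fin m)))
    (e : Module.Basis (Fin m) ℝ (EuclideanSpace ℝ (Fin m))) (i j : Fin m) :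
    ((columns e)ᵀ * (Matrix.of fun i j => F (EuclideanSpace.single i 1)
      (EuclideanSpace.single j 1)) * columns e) i j = F (e i) (e j) := by
  have h := apply_eq_sum_repr F (EuclideanSpace.basisFun (Fin m) ℝ).toBasis (e i) (e j)
  simp only [OrthonormalBasis.coe_toBasis, EuclideanSpace.basisFun_apply,
    OrthonormalBasis.coe_toBasis_repr_apply, EuclideanSpace.basisFun_repr] at h
  rw [h, Matrix.mul_apply]
  simp only [Matrix.mul_apply, Matrix.transpose_apply, columns, Matrix.of_apply, Finset.sum_mul]
  rw [Finset.sum_comm]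
  exact Finset.sum_congr rfl fun x _ => Finset.sum_congr rfl fun y _ => by ring

lemma columns_gramMatrix {B : LinearMap.BilinForm ℝ E} {k : ℕ}
    {D : EuclideanSpace ℝ (Fin m) →L[ℝ] E}
    {e : Module.Basis (Fin m) ℝ (EuclideanSpace ℝ (Fin m))}
    (he : IsLorentzBasis (pullbackForm B D) k e) :
    (columns e)ᵀ * gramMatrix B D * columns e = Matrix.diagonal (sign k) := by
  ext i j
  rw [show gramMatrix B D = Matrix.of fun i j => pullbackForm B D (EuclideanSpace.single i 1)
    (EuclideanSpace.single j 1) from rfl, columns_transpose_mul_mul, he, Matrix.diagonal_apply]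

lemma prod_sign {k : ℕ} (hkm : k ≤ m) : ∏ j : Fin m, sign k j = (-1) ^ k := by
  obtain ⟨l, rfl⟩ := Nat.exists_eq_add_of_le hkm
  simp [Fin.prod_univ_add, sign]

lemma det_gramMatrix_pos {B : LinearMap.BilinForm ℝ E} {k : ℕ} (hkm : k ≤ m)
    {D : EuclideanSpace ℝ (Fin m) →L[ℝ] E}
    {e : Module.Basis (Fin m) ℝ (EuclideanSpace ℝ (Fin m))}
    (he : IsLorentzBasis (pullbackForm B D) k e) : 0 < (-1) ^ k * (gramMatrix B D).det := by
  have h := congrArg Matrix.det (columns_gramMatrix he)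
  rw [Matrix.det_mul, Matrix.det_mul, Matrix.det_transpose, Matrix.det_diagonal, prod_sign hkm] at h
  have h1 : (columns e).det ^ 2 * ((-1) ^ k * (gramMatrix B D).det) = 1 := by
    have h2 : ((-1 : ℝ) ^ k) * (-1) ^ k = 1 := by rw [← mul_pow]; simp
    linear_combination (-1) ^ k * h + h2
  exact pos_of_mul_pos_right (h1 ▸ one_pos) (sq_nonneg _)

/-- A trace with respect to the induced metric, computed in a Lorentz basis. -/
lemma trace_inv_gramMatrix_mul {B : LinearMap.BilinForm ℝ E} {k : ℕ}
    {D : EuclideanSpace ℝ (Fin m) →L[ℝ] E}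
    {e : Module.Basis (Fin m) ℝ (EuclideanSpace ℝ (Fin m))}
    (he : IsLorentzBasis (pullbackForm B D) k e)
    (F : LinearMap.BilinForm ℝ (EuclideanSpace ℝ (Fin m))) :
    Matrix.trace ((gramMatrix B D)⁻¹ * Matrix.of fun i j => F (EuclideanSpace.single i 1)
      (EuclideanSpace.single j 1)) = ∑ j, sign k j * F (e j) (e j) := by
  set P := columns e
  set S : Matrix (Fin m) (Fin m) ℝ := Matrix.diagonal (sign k)
  have hS : S * S = 1 := by
    simp only [S, Matrix.diagonal_mul_diagonal, sign_mul_self, Matrix.diagonal_one]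
  have h1 : S * Pᵀ * gramMatrix B D * P = 1 := by
    rw [Matrix.mul_assoc, Matrix.mul_assoc, ← Matrix.mul_assoc Pᵀ, columns_gramMatrix he, hS]
  have h2 : (P * S * Pᵀ) * gramMatrix B D = 1 := by
    rw [Matrix.mul_assoc, Matrix.mul_assoc, ← Matrix.mul_assoc S]
    exact mul_eq_one_comm.1 h1
  rw [Matrix.inv_eq_left_inv h2, Matrix.mul_assoc, Matrix.mul_assoc, Matrix.trace_mul_comm,
    Matrix.mul_assoc, Matrix.trace]
  refine Finset.sum_congr rfl fun j _ => ?_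
  rw [Matrix.diag_apply, Matrix.diagonal_mul, columns_transpose_mul_mul]

lemma trace_inv_mul_crossMatrix {B : LinearMap.BilinForm ℝ E} (hs : ∀ x y, B x y = B y x) {k : ℕ}
    {D D' : EuclideanSpace ℝ (Fin m) →L[ℝ] E}
    {e : Module.Basis (Fin m) ℝ (EuclideanSpace ℝ (Fin m))}
    (he : IsLorentzBasis (pullbackForm B D) k e) :
    Matrix.trace ((gramMatrix B D)⁻¹ * crossMatrix B D D')
      = 2 * ∑ j, sign k j * B (D (e j)) (D' (e j)) := by
  have h := trace_inv_gramMatrix_mul he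
    (B.compl₁₂ (D : EuclideanSpace ℝ (Fin m) →ₗ[ℝ] E) (D' : EuclideanSpace ℝ (Fin m) →ₗ[ℝ] E) +
     B.compl₁₂ (D' : EuclideanSpace ℝ (Fin m) →ₗ[ℝ] E) (D : EuclideanSpace ℝ (Fin m) →ₗ[ℝ] E))
  refine Eq.trans h ?_
  rw [Finset.mul_sum]
  refine Finset.sum_congr rfl fun j _ => ?_
  simp only [LinearMap.add_apply, LinearMap.compl₁₂_apply, ContinuousLinearMap.coe_coe,
    hs (D' (e j))]
  ring

lemma trace_inv_mul_squareMatrix {B : LinearMap.BilinForm ℝ E} {k : ℕ}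
    {D : EuclideanSpace ℝ (Fin m) →L[ℝ] E}
    {e : Module.Basis (Fin m) ℝ (EuclideanSpace ℝ (Fin m))}
    (he : IsLorentzBasis (pullbackForm B D) k e) (l : EuclideanSpace ℝ (Fin m) →L[ℝ] ℝ) :
    Matrix.trace ((gramMatrix B D)⁻¹ * squareMatrix l) = ∑ j, sign k j * l (e j) ^ 2 := by
  have h := trace_inv_gramMatrix_mul he
    ((LinearMap.mul ℝ ℝ).compl₁₂ (l : EuclideanSpace ℝ (Fin m) →ₗ[ℝ] ℝ)
      (l : EuclideanSpace ℝ (Fin m) →ₗ[ℝ] ℝ))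
  refine Eq.trans h (Finset.sum_congr rfl fun j _ => ?_)
  simp only [LinearMap.compl₁₂_apply, ContinuousLinearMap.coe_coe, LinearMap.mul_apply']
  ring

section Smooth

variable {V : Type*} [NormedAddCommGroup V] [NormedSpace ℝ V] {U : Set V}

lemma contDiffOn_bilin [FiniteDimensional ℝ E] (B : LinearMap.BilinForm ℝ E) {f g : V → E}
    (hf : ContDiffOn ℝ ∞ f U) (hg : ContDiffOn ℝ ∞ g U) :
    ContDiffOn ℝ ∞ (fun u => B (f u) (g u)) U :=
  (B.toContinuousBilinearMap.contDiff.comp_contDiffOn hf).clm_apply hg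

lemma contDiffOn_det {A : V → Matrix (Fin m) (Fin m) ℝ}
    (hA : ∀ i j, ContDiffOn ℝ ∞ (fun u => A u i j) U) :
    ContDiffOn ℝ ∞ (fun u => (A u).det) U := by
  simp only [Matrix.det_apply']
  exact ContDiffOn.sum fun σ _ => contDiffOn_const.mul (contDiffOn_prod fun i _ => hA _ _)

lemma contDiffOn_adjugate {A : V → Matrix (Fin m) (Fin m) ℝ}
    (hA : ∀ i j, ContDiffOn ℝ ∞ (fun u => A u i j) U) (i j : Fin m) :
    ContDiffOn ℝ ∞ (fun u => (A u).adjugate i j) U := by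
  simp only [Matrix.adjugate_apply]
  refine contDiffOn_det fun a b => ?_
  simp only [Matrix.updateRow_apply]
  split_ifs
  · exact contDiffOn_const
  · exact hA a b

end Smooth

/-- The component of `x` normal to the image of `D`, up to the factor `det g`. Clearing the
denominator keeps this polynomial in the data. -/
def normalPart (B : LinearMap.BilinForm ℝ E) (x : E) (D : EuclideanSpace ℝ (Fin m) →L[ℝ] E) : E :=
  (gramMatrix B D).det • x - ∑ i, ∑ j, ((gramMatrix B D).adjugate i j *
    B (D (EuclideanSpace.single j 1)) x) • D (EuclideanSpace.single i 1)

lemma apply_normalPart (B : LinearMap.BilinForm ℝ E) (x : E)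
    (D : EuclideanSpace ℝ (Fin m) →L[ℝ] E) (v : EuclideanSpace ℝ (Fin m)) :
    B (D v) (normalPart B x D) = 0 := by
  have hbasis : ∀ l, B (D (EuclideanSpace.single l 1)) (normalPart B x D) = 0 := fun l => by
    have h := Matrix.mul_adjugate (gramMatrix B D)
    have h1 : ∀ j, ∑ i, gramMatrix B D l i * (gramMatrix B D).adjugate i j
        = (gramMatrix B D).det * if l = j then 1 else 0 := fun j => by
      rw [← Matrix.mul_apply, h]; simp [Matrix.one_apply]
    simp only [normalPart, map_sub, map_sum, map_smul, smul_eq_mul]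
    rw [Finset.sum_comm]
    have h2 : ∀ j, ∑ i, (gramMatrix B D).adjugate i j * B (D (EuclideanSpace.single j 1)) x *
        B (D (EuclideanSpace.single l 1)) (D (EuclideanSpace.single i 1))
        = B (D (EuclideanSpace.single j 1)) x * ((gramMatrix B D).det * if l = j then 1 else 0) :=
      fun j => by
        rw [← h1, Finset.mul_sum]
        refine Finset.sum_congr rfl fun i _ => ?_
        simp only [gramMatrix, Matrix.of_apply]; ring
    simp only [h2]
    simp
    ring
  have hv : v = ∑ i, v i • EuclideanSpace.single i (1 : ℝ) := by
    simpa using ((EuclideanSpace.basisFun (Fin m) ℝ).sum_repr v).symm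
  rw [hv]
  simp [hbasis]

lemma normalPart_of_orthogonal {B : LinearMap.BilinForm ℝ E} {x : E}
    {D : EuclideanSpace ℝ (Fin m) →L[ℝ] E} (h : ∀ v, B (D v) x = 0) :
    normalPart B x D = (gramMatrix B D).det • x := by
  simp [normalPart, h]

lemma contDiffOn_normalPart [FiniteDimensional ℝ E] {V : Type*} [NormedAddCommGroup V]
    [NormedSpace ℝ V] {U : Set V} (B : LinearMap.BilinForm ℝ E) (x : E)
    {D : V → EuclideanSpace ℝ (Fin m) →L[ℝ] E} (hD : ContDiffOn ℝ ∞ D U) :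
    ContDiffOn ℝ ∞ (fun u => normalPart B x (D u)) U := by
  have h1 : ∀ v, ContDiffOn ℝ ∞ (fun u => D u v) U := fun v => hD.clm_apply contDiffOn_const
  have h2 : ∀ i j, ContDiffOn ℝ ∞ (fun u => gramMatrix B (D u) i j) U := fun i j =>
    contDiffOn_bilin B (h1 _) (h1 _)
  exact ((contDiffOn_det h2).smul contDiffOn_const).sub
    (ContDiffOn.sum fun i _ => ContDiffOn.sum fun j _ =>
      ((contDiffOn_adjugate h2 i j).mul (contDiffOn_bilin B (h1 _) contDiffOn_const)).smul (h1 _))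

end Gram

/-! ### The second variation in a chart -/

section SecondVariation

open Matrix Metric Topology

variable {m : ℕ} {E : Type*} [NormedAddCommGroup E] [NormedSpace ℝ E]

local notation "𝕍" => EuclideanSpace ℝ (Fin m)

/-- The integrand of the second derivative of the volume along `f ξ`, where `g` is the induced
metric, `D = dφ`, `D' = dξ`, `x = ξ`: it is `√|det g|` times twice the second order coefficient of
`√(det (g⁻¹ g_t))`, and that is the second order coefficient of `det (g⁻¹ g_t)` when the first
order coefficient vanishes. -/
def secondVariationDensity (B : LinearMap.BilinForm ℝ E) (k : ℕ) (D D' : 𝕍 →L[ℝ] E) (x : E)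
    (f : ℝ) (df : 𝕍 →L[ℝ] ℝ) : ℝ :=
  Real.sqrt ((-1) ^ k * (gramMatrix B D).det) *
    (trace ((gramMatrix B D)⁻¹ * gramMatrix B (productDeriv D' x f df))
      + detRemainder (f • ((gramMatrix B D)⁻¹ * crossMatrix B D D')) 0)

lemma secondVariationDensity_cos_add_sin (B : LinearMap.BilinForm ℝ E) (k : ℕ) (D D' : 𝕍 →L[ℝ] E)
    (x : E) (η r a : ℝ) (dη l : 𝕍 →L[ℝ] ℝ) :
    secondVariationDensity B k D D' x (η * Real.cos a)
        (Real.cos a • dη - (r * η * Real.sin a) • l)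
      + secondVariationDensity B k D D' x (η * Real.sin a)
        (Real.sin a • dη + (r * η * Real.cos a) • l)
      = secondVariationDensity B k D D' x η dη + r ^ 2 *
        (Real.sqrt ((-1) ^ k * (gramMatrix B D).det) * η ^ 2 *
          (B x x * trace ((gramMatrix B D)⁻¹ * squareMatrix l))) := by
  have h := congrArg (fun N => trace ((gramMatrix B D)⁻¹ * N))
    (gramMatrix_cos_add_sin B D' x η r a dη l)
  simp only [Matrix.mul_add, trace_add, Matrix.mul_smul, trace_smul, smul_eq_mul] at h
  simp only [secondVariationDensity, detRemainder_smul_zero]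
  linear_combination Real.sqrt ((-1) ^ k * (gramMatrix B D).det) * h +
    Real.sqrt ((-1) ^ k * (gramMatrix B D).det) * η ^ 2 *
      detRemainder ((gramMatrix B D)⁻¹ * crossMatrix B D D') 0 * Real.sin_sq_add_cos_sq a

section Continuity

variable [FiniteDimensional ℝ E] {Y : Type*} [TopologicalSpace Y]

lemma continuous_gramMatrix (B : LinearMap.BilinForm ℝ E) {D : Y → 𝕍 →L[ℝ] E} (hD : Continuous D) :
    Continuous fun y => gramMatrix B (D y) :=
  continuous_matrix fun _ _ => (B.toContinuousBilinearMap.continuous.comp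
    (hD.clm_apply continuous_const)).clm_apply (hD.clm_apply continuous_const)

lemma continuous_crossMatrix (B : LinearMap.BilinForm ℝ E) {D D' : Y → 𝕍 →L[ℝ] E}
    (hD : Continuous D) (hD' : Continuous D') : Continuous fun y => crossMatrix B (D y) (D' y) :=
  continuous_matrix fun _ _ => ((B.toContinuousBilinearMap.continuous.comp
    (hD.clm_apply continuous_const)).clm_apply (hD'.clm_apply continuous_const)).add
    ((B.toContinuousBilinearMap.continuous.comp
    (hD'.clm_apply continuous_const)).clm_apply (hD.clm_apply continuous_const))

omit [FiniteDimensional ℝ E] in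
lemma continuous_productDeriv {D' : Y → 𝕍 →L[ℝ] E} {x : Y → E} {f : Y → ℝ} {df : Y → 𝕍 →L[ℝ] ℝ}
    (hD' : Continuous D') (hx : Continuous x) (hf : Continuous f) (hdf : Continuous df) :
    Continuous fun y => productDeriv (D' y) (x y) (f y) (df y) :=
  (hf.smul hD').add
    (((ContinuousLinearMap.smulRightL ℝ 𝕍 E).continuous.comp hdf).clm_apply hx)

lemma continuous_inv_of_det_ne_zero {A : Y → Matrix (Fin m) (Fin m) ℝ} (hA : Continuous A)
    (h : ∀ y, (A y).det ≠ 0) : Continuous fun y => (A y)⁻¹ := by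
  simp only [Matrix.inv_def, Ring.inverse_eq_inv']
  exact (hA.matrix_det.inv₀ h).smul hA.matrix_adjugate

lemma continuous_secondVariationDensity (B : LinearMap.BilinForm ℝ E) (k : ℕ)
    {D D' : Y → 𝕍 →L[ℝ] E} {x : Y → E} {f : Y → ℝ} {df : Y → 𝕍 →L[ℝ] ℝ}
    (hD : Continuous D) (hD' : Continuous D') (hx : Continuous x) (hf : Continuous f)
    (hdf : Continuous df) (h : ∀ y, (gramMatrix B (D y)).det ≠ 0) :
    Continuous fun y => secondVariationDensity B k (D y) (D' y) (x y) (f y) (df y) := by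
  have hg := continuous_gramMatrix B hD
  have hinv := continuous_inv_of_det_ne_zero hg h
  have hgram := continuous_gramMatrix B (continuous_productDeriv hD' hx hf hdf)
  have hcross := continuous_crossMatrix B hD hD'
  unfold secondVariationDensity
  refine (Real.continuous_sqrt.comp (continuous_const.mul hg.matrix_det)).mul (Continuous.add
    (hinv.matrix_mul hgram).matrix_trace (continuous_detRemainder.comp
      (Continuous.prodMk (hf.smul (hinv.matrix_mul hcross)) continuous_const)))

end Continuity

lemma continuous_coe_of_continuousOn {X Z : Type*} [TopologicalSpace X] [TopologicalSpace Z]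
    {F : X → Z} {K U : Set X} (h : K ⊆ U) (hF : ContinuousOn F U) : Continuous fun y : K => F y :=
  (hF.mono h).comp_continuous continuous_subtype_val fun y => y.2

lemma hasFDerivAt_mul_cos {η : 𝕍 → ℝ} {u : 𝕍} (hη : DifferentiableAt ℝ η u) (r : ℝ)
    (l : 𝕍 →L[ℝ] ℝ) : HasFDerivAt (fun v => η v * Real.cos (r * l v))
      (Real.cos (r * l u) • fderiv ℝ η u - (r * η u * Real.sin (r * l u)) • l) u := by
  have h1 : HasFDerivAt (fun v => r * l v) (r • l) u := l.hasFDerivAt.const_mul r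
  refine (hη.hasFDerivAt.mul h1.cos).congr_fderiv ?_
  ext v
  simp
  ring

lemma hasFDerivAt_mul_sin {η : 𝕍 → ℝ} {u : 𝕍} (hη : DifferentiableAt ℝ η u) (r : ℝ)
    (l : 𝕍 →L[ℝ] ℝ) : HasFDerivAt (fun v => η v * Real.sin (r * l v))
      (Real.sin (r * l u) • fderiv ℝ η u + (r * η u * Real.cos (r * l u)) • l) u := by
  have h1 : HasFDerivAt (fun v => r * l v) (r • l) u := l.hasFDerivAt.const_mul r
  refine (hη.hasFDerivAt.mul h1.sin).congr_fderiv ?_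
  ext v
  simp
  ring

variable [FiniteDimensional ℝ E]

/-- The measure that Lebesgue measure induces on a closed ball, considered as a space. -/
abbrev ballMeasure (u₀ : 𝕍) (r : ℝ) : Measure (closedBall u₀ r) :=
  (volume : Measure 𝕍).comap Subtype.val

lemma isFiniteMeasure_ballMeasure (u₀ : 𝕍) (r : ℝ) : IsFiniteMeasure (ballMeasure u₀ r) := by
  constructor
  rw [ballMeasure, (MeasurableEmbedding.subtype_coe measurableSet_closedBall).comap_apply,
    image_univ, Subtype.range_coe]
  exact measure_closedBall_lt_top

/-- A cut off rapid oscillation in a direction `ℓ` gives the second variation the sign of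
`⟨ξ, ξ⟩ g⁻¹(ℓ, ℓ)`: for large frequency, this sign appears in the sum of the second variations for
`cos` and `sin`, hence in one of them. -/
lemma exists_oscillation (B : LinearMap.BilinForm ℝ E) (k : ℕ) {U : Set 𝕍} (hU : IsOpen U)
    {u₀ : 𝕍} {r : ℝ} (hr : 0 < r) (hball : closedBall u₀ r ⊆ U) {D : 𝕍 → 𝕍 →L[ℝ] E} {ξ : 𝕍 → E}
    {η : 𝕍 → ℝ} (hD : ContinuousOn D U) (hξ : ContDiffOn ℝ ∞ ξ U) (hη : ContDiffOn ℝ ∞ η U)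
    (hdet : ∀ u ∈ U, 0 < (-1) ^ k * (gramMatrix B (D u)).det) (hη0 : ∀ u ∈ ball u₀ r, η u ≠ 0)
    (l : 𝕍 →L[ℝ] ℝ) (s : ℝ)
    (hpos : ∀ u ∈ closedBall u₀ r,
      0 < s * (B (ξ u) (ξ u) * trace ((gramMatrix B (D u))⁻¹ * squareMatrix l))) :
    ∃ h : 𝕍 → ℝ, ContDiff ℝ ∞ h ∧
      0 < s * ∫ y : closedBall u₀ r, secondVariationDensity B k (D y) (fderiv ℝ ξ y) (ξ y)
        (η y * h y) (fderiv ℝ (fun v => η v * h v) y) ∂(ballMeasure u₀ r) := by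
  have : IsFiniteMeasure (ballMeasure u₀ r) := isFiniteMeasure_ballMeasure u₀ r
  have : CompactSpace (closedBall u₀ r) := isCompact_iff_compactSpace.1 (isCompact_closedBall u₀ r)
  have hint : ∀ F : closedBall u₀ r → ℝ, Continuous F → Integrable F (ballMeasure u₀ r) :=
    fun F hF => hF.integrable_of_hasCompactSupport (HasCompactSupport.of_compactSpace F)
  have hyU : ∀ y : closedBall u₀ r, (y : 𝕍) ∈ U := fun y => hball y.2
  have hdet0 : ∀ y : closedBall u₀ r, (gramMatrix B (D y)).det ≠ 0 := fun y h0 => by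
    have := hdet y (hyU y)
    simp [h0] at this
  have hDc := continuous_coe_of_continuousOn hball hD
  have hξc : Continuous fun y : closedBall u₀ r => ξ y :=
    continuous_coe_of_continuousOn hball hξ.continuousOn
  have hdξc : Continuous fun y : closedBall u₀ r => fderiv ℝ ξ y :=
    continuous_coe_of_continuousOn hball (hξ.continuousOn_fderiv_of_isOpen hU (by simp))
  have hcont : ∀ f : 𝕍 → ℝ, ContDiffOn ℝ ∞ f U → Continuous fun y : closedBall u₀ r =>
      secondVariationDensity B k (D y) (fderiv ℝ ξ y) (ξ y) (f y) (fderiv ℝ f y) := fun f hf =>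
    continuous_secondVariationDensity B k hDc hdξc hξc
      (continuous_coe_of_continuousOn hball hf.continuousOn)
      (continuous_coe_of_continuousOn hball (hf.continuousOn_fderiv_of_isOpen hU (by simp))) hdet0
  set J : (𝕍 → ℝ) → ℝ := fun f => ∫ y : closedBall u₀ r, secondVariationDensity B k (D y)
    (fderiv ℝ ξ y) (ξ y) (f y) (fderiv ℝ f y) ∂(ballMeasure u₀ r) with hJ
  set G : closedBall u₀ r → ℝ := fun y => Real.sqrt ((-1) ^ k * (gramMatrix B (D y)).det) *
    η y ^ 2 * (B (ξ y) (ξ y) * trace ((gramMatrix B (D y))⁻¹ * squareMatrix l)) with hG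
  have hgram := continuous_gramMatrix B hDc
  have hGc : Continuous G := by
    refine Continuous.mul (Continuous.mul
      (Real.continuous_sqrt.comp (continuous_const.mul hgram.matrix_det))
      ((continuous_coe_of_continuousOn hball hη.continuousOn).pow 2)) (Continuous.mul
        ((B.toContinuousBilinearMap.continuous.comp hξc).clm_apply hξc)
        ((continuous_inv_of_det_ne_zero hgram hdet0).matrix_mul continuous_const).matrix_trace)
  have hGpos : 0 < s * ∫ y, G y ∂(ballMeasure u₀ r) := by
    have hsG : ∀ y, s * G y = Real.sqrt ((-1) ^ k * (gramMatrix B (D y)).det) * η y ^ 2 *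
        (s * (B (ξ y) (ξ y) * trace ((gramMatrix B (D y))⁻¹ * squareMatrix l))) := fun y => by
      simp only [hG]; ring
    have hnn : ∀ y, 0 ≤ s * G y := fun y => by
      rw [hsG]
      exact mul_nonneg (by positivity) (hpos y y.2).le
    rw [← integral_const_mul]
    rw [integral_pos_iff_support_of_nonneg hnn (hint _ (continuous_const.mul hGc))]
    have hsub : (Subtype.val ⁻¹' ball u₀ r : Set (closedBall u₀ r)) ⊆
        Function.support fun y => s * G y := fun y hy => by
      rw [Function.mem_support, hsG]
      have h1 := Real.sqrt_pos.2 (hdet y (hyU y))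
      have h2 : 0 < η y ^ 2 := by have := hη0 y hy; positivity
      exact (mul_pos (mul_pos h1 h2) (hpos y y.2)).ne'
    refine lt_of_lt_of_le ?_ (measure_mono hsub)
    rw [ballMeasure, (MeasurableEmbedding.subtype_coe measurableSet_closedBall).comap_apply,
      Subtype.image_preimage_coe, inter_eq_self_of_subset_right ball_subset_closedBall]
    exact measure_ball_pos volume u₀ hr
  set c := s * ∫ y, G y ∂(ballMeasure u₀ r)
  -- A frequency for which `R² c` outweighs the second derivative along `η ξ`.
  obtain ⟨R, hR⟩ : ∃ R : ℝ, 0 < s * J η + R ^ 2 * c := by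
    refine ⟨|s * J η| / c + 1, ?_⟩
    have h1 : 0 ≤ |s * J η| / c := by positivity
    have h2 : |s * J η| / c * c = |s * J η| := div_mul_cancel₀ _ hGpos.ne'
    nlinarith [neg_abs_le (s * J η), mul_nonneg (mul_nonneg h1 h1) hGpos.le]
  have hcos : ContDiff ℝ ∞ fun v : 𝕍 => Real.cos (R * l v) :=
    Real.contDiff_cos.comp (contDiff_const.mul l.contDiff)
  have hsin : ContDiff ℝ ∞ fun v : 𝕍 => Real.sin (R * l v) :=
    Real.contDiff_sin.comp (contDiff_const.mul l.contDiff)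
  have hsum : J (fun v => η v * Real.cos (R * l v)) + J (fun v => η v * Real.sin (R * l v))
      = J η + R ^ 2 * ∫ y, G y ∂(ballMeasure u₀ r) := by
    simp only [hJ]
    rw [← integral_const_mul, ← integral_add (hint _ (hcont _ (hη.mul hcos.contDiffOn)))
      (hint _ (hcont _ (hη.mul hsin.contDiffOn))), ← integral_add (hint _ (hcont η hη))
      (hint (fun y => R ^ 2 * G y) (continuous_const.mul hGc))]
    refine integral_congr_ae (Filter.Eventually.of_forall fun y => ?_)
    have hd := differentiableAt_of_contDiffOn hη hU (hyU y)
    simp only [(hasFDerivAt_mul_cos hd R l).fderiv, (hasFDerivAt_mul_sin hd R l).fderiv]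
    exact secondVariationDensity_cos_add_sin B k _ _ _ _ _ _ _ _
  have hor : 0 < s * J (fun v => η v * Real.cos (R * l v)) ∨
      0 < s * J (fun v => η v * Real.sin (R * l v)) := by
    by_contra! hcon
    have : s * (J (fun v => η v * Real.cos (R * l v)) + J (fun v => η v * Real.sin (R * l v)))
        = s * J η + R ^ 2 * c := by rw [hsum]; ring
    linarith [hcon.1, hcon.2]
  rcases hor with h | h
  · exact ⟨_, hcos, h⟩
  · exact ⟨_, hsin, h⟩

/-- The comparison of volumes and the persistence of the index, for the parametrisations with
derivative `D + t (f dξ + df ξ)` and `t` near `0`. -/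
lemma eventually_volume_and_index {B : LinearMap.BilinForm ℝ E} (hs : ∀ x y, B x y = B y x)
    {k : ℕ} (hkm : k ≤ m) {Y : Type*} [TopologicalSpace Y] [CompactSpace Y] [MeasurableSpace Y]
    [BorelSpace Y] (μ : Measure Y) [IsFiniteMeasure μ] {D D' : Y → 𝕍 →L[ℝ] E} {x : Y → E}
    {f : Y → ℝ} {df : Y → 𝕍 →L[ℝ] ℝ} (hD : Continuous D) (hD' : Continuous D') (hx : Continuous x)
    (hf : Continuous f) (hdf : Continuous df) (hn : ∀ y v, B (D y v) (x y) = 0)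
    (hdet : ∀ y, 0 < (-1) ^ k * (gramMatrix B (D y)).det)
    (htr : ∀ y, trace ((gramMatrix B (D y))⁻¹ * crossMatrix B (D y) (D' y)) = 0)
    (e : Module.Basis (Fin m) ℝ 𝕍)
    (he : ∀ y i j, |B (D y (e i)) (D y (e j)) - if i = j then sign k i else 0| < 1 / (m + 1))
    (s : ℝ)
    (hJ : 0 < s * ∫ y, secondVariationDensity B k (D y) (D' y) (x y) (f y) (df y) ∂μ) :
    ∀ᶠ t in 𝓝 (0 : ℝ),
      (∀ y, HasIndex (pullbackForm B (D y + t • productDeriv (D' y) (x y) (f y) (df y))) k) ∧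
      (t ≠ 0 → 0 < s * (∫ y, Real.sqrt ((-1) ^ k *
          (gramMatrix B (D y + t • productDeriv (D' y) (x y) (f y) (df y))).det) ∂μ
        - ∫ y, Real.sqrt ((-1) ^ k * (gramMatrix B (D y)).det) ∂μ)) := by
  have hdet0 : ∀ y, (gramMatrix B (D y)).det ≠ 0 := fun y h0 => by
    have := hdet y
    simp [h0] at this
  have hg := continuous_gramMatrix B hD
  have hinv := continuous_inv_of_det_ne_zero hg hdet0
  have hprod := continuous_productDeriv hD' hx hf hdf
  have hvol := eventually_integral_sqrt_det μ (d := fun y => (-1) ^ k * (gramMatrix B (D y)).det)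
    (continuous_const.mul hg.matrix_det) hdet
    (M₁ := fun y => f y • ((gramMatrix B (D y))⁻¹ * crossMatrix B (D y) (D' y)))
    (M₂ := fun y => (gramMatrix B (D y))⁻¹ *
      gramMatrix B (productDeriv (D' y) (x y) (f y) (df y)))
    (hf.smul (hinv.matrix_mul (continuous_crossMatrix B hD hD')))
    (hinv.matrix_mul (continuous_gramMatrix B hprod))
    (fun y => by rw [trace_smul, htr, smul_zero]) s hJ
  have hfac : ∀ (t : ℝ) (y : Y), (-1) ^ k * (gramMatrix B (D y)).det *
      det (1 + t • (f y • ((gramMatrix B (D y))⁻¹ * crossMatrix B (D y) (D' y))) +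
        t ^ 2 • ((gramMatrix B (D y))⁻¹ * gramMatrix B (productDeriv (D' y) (x y) (f y) (df y))))
      = (-1) ^ k * (gramMatrix B (D y + t • productDeriv (D' y) (x y) (f y) (df y))).det :=
    fun t y => by
      rw [mul_assoc, ← det_mul, gramMatrix_add_smul_productDeriv hs (hn y)]
      have h1 := Matrix.mul_nonsing_inv_cancel_left (A := gramMatrix B (D y))
        (crossMatrix B (D y) (D' y)) (isUnit_iff_ne_zero.2 (hdet0 y))
      have h2 := Matrix.mul_nonsing_inv_cancel_left (A := gramMatrix B (D y))
        (gramMatrix B (productDeriv (D' y) (x y) (f y) (df y))) (isUnit_iff_ne_zero.2 (hdet0 y))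
      simp only [Matrix.mul_add, Matrix.mul_one, Matrix.mul_smul, h1, h2]
  simp only [hfac] at hvol
  have hidx : ∀ᶠ t in 𝓝 (0 : ℝ), ∀ y ∈ (univ : Set Y), ∀ i j,
      |B ((D y + t • productDeriv (D' y) (x y) (f y) (df y)) (e i))
        ((D y + t • productDeriv (D' y) (x y) (f y) (df y)) (e j))
        - if i = j then sign k i else 0| < 1 / (m + 1) := by
    refine isCompact_univ.eventually_forall_of_forall_eventually fun y _ => ?_
    rw [Filter.eventually_all]; intro i
    rw [Filter.eventually_all]; intro j
    have hDt : Continuous fun p : ℝ × Y =>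
        D p.2 + p.1 • productDeriv (D' p.2) (x p.2) (f p.2) (df p.2) :=
      (hD.comp continuous_snd).add (continuous_fst.smul (hprod.comp continuous_snd))
    have hc : Continuous fun p : ℝ × Y =>
        |B ((D p.2 + p.1 • productDeriv (D' p.2) (x p.2) (f p.2) (df p.2)) (e i))
        ((D p.2 + p.1 • productDeriv (D' p.2) (x p.2) (f p.2) (df p.2)) (e j))
        - if i = j then sign k i else 0| :=
      (((B.toContinuousBilinearMap.continuous.comp (hDt.clm_apply continuous_const)).clm_apply
        (hDt.clm_apply continuous_const)).sub continuous_const).abs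
    refine hc.continuousAt.eventually_lt_const ?_
    simpa using he y i j
  filter_upwards [hvol, hidx] with t h1 h2
  refine ⟨fun y => hasIndex_of_close hkm _ (fun v w => hs _ _) e fun i j =>
    (h2 y (mem_univ y) i j).le, h1.2⟩

end SecondVariation

/-! ### Variations of minimal submanifolds that raise or lower the volume -/

section Variation

open Matrix Metric Topology

variable {m : ℕ} {M : Type*} [TopologicalSpace M] [ChartedSpace (EuclideanSpace ℝ (Fin m)) M]
  [IsManifold (𝓡 m) ∞ M] {E : Type*} [NormedAddCommGroup E] [NormedSpace ℝ E]
  [FiniteDimensional ℝ E]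

local notation "𝕍" => EuclideanSpace ℝ (Fin m)

lemma IsLorentzBasis.map_symm {V V' : Type*} [AddCommGroup V] [Module ℝ V] [AddCommGroup V']
    [Module ℝ V'] {g : LinearMap.BilinForm ℝ V} {g' : LinearMap.BilinForm ℝ V'} {k : ℕ}
    {e : Module.Basis (Fin m) ℝ V} (he : IsLorentzBasis g k e) (L : V' ≃ₗ[ℝ] V)
    (h : ∀ x y, g' x y = g (L x) (L y)) : IsLorentzBasis g' k (e.map L.symm) := fun i j => by
  simp [h, he i j]

/-- In a chart, minimality says that the first variation of `det g` along a normal field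
vanishes. -/
lemma IsMinimal.trace_crossMatrix_eq_zero {B : LinearMap.BilinForm ℝ E}
    (hs : ∀ x y, B x y = B y x) {k : ℕ} {φ : M → E} (hφ : IsIndefiniteSubmanifold m B k φ)
    (hmin : IsMinimal m B k φ) {c : OpenPartialHomeomorph M 𝕍}
    (hc : c ∈ IsManifold.maximalAtlas (𝓡 m) ∞ M) {ξ : 𝕍 → E} (hξ : ContDiffOn ℝ ∞ ξ c.target)
    (hn : ∀ u ∈ c.target, ∀ v, B (fderiv ℝ (φ ∘ c.symm) u v) (ξ u) = 0) {u : 𝕍}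
    (hu : u ∈ c.target) :
    trace ((gramMatrix B (fderiv ℝ (φ ∘ c.symm) u))⁻¹ *
      crossMatrix B (fderiv ℝ (φ ∘ c.symm) u) (fderiv ℝ ξ u)) = 0 := by
  obtain ⟨L, hL⟩ := exists_chart_equiv (E := E) hc hu
  have hLφ := hL φ (mdifferentiableAt_of_contMDiff hφ.1 _)
  have hq : c.symm u ∈ c.source := c.map_target hu
  have hξd : MDifferentiableAt (𝓡 m) 𝓘(ℝ, E) (ξ ∘ c) (c.symm u) := by
    have h1 : MDifferentiableAt (𝓡 m) 𝓘(ℝ, E) ξ (c (c.symm u)) := by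
      rw [c.right_inv hu]
      exact (differentiableAt_of_contDiffOn hξ c.open_target hu).mdifferentiableAt
    exact h1.comp _ ((contMDiffAt_of_mem_maximalAtlas hc hq).mdifferentiableAt (by simp))
  have hLξ := hL _ hξd
  have hev : (ξ ∘ c) ∘ c.symm =ᶠ[𝓝 u] ξ := by
    filter_upwards [c.open_target.mem_nhds hu] with w hw
    simp [c.right_inv hw]
  rw [hev.fderiv_eq] at hLξ
  obtain ⟨e, he⟩ := (hφ.2 (c.symm u)).exists_isLorentzBasis (finrank_tangentSpace _)
    fun v w => hs _ _
  have he' : IsLorentzBasis (pullbackForm B (fderiv ℝ (φ ∘ c.symm) u)) k (e.map L.symm) :=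
    he.map_symm L fun v w => by rw [inducedMetric_apply, hLφ, hLφ, pullbackForm_apply]
  have hsum := hmin.sum_sign_mul_eq_zero hs hφ hξd (by
    filter_upwards [c.open_source.mem_nhds hq] with q hqs
    have := (mem_normalSpace_symm_iff B hφ.1 hc (c.map_source hqs) (ξ (c q))).2
      (hn _ (c.map_source hqs))
    rwa [c.left_inv hqs] at this) he
  rw [trace_inv_mul_crossMatrix hs he']
  simp only [Module.Basis.map_apply, ← hLφ, ← hLξ, LinearEquiv.apply_symm_apply]
  rw [hsum, mul_zero]

omit [IsManifold (𝓡 m) ∞ M] [ChartedSpace (EuclideanSpace ℝ (Fin m)) M] in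
/-- The volume of a coordinate ball as an integral over the ball. -/
lemma chartVolume_symm_image_closedBall (B : LinearMap.BilinForm ℝ E) (k : ℕ) {φ : M → E}
    {c : OpenPartialHomeomorph M 𝕍} {u₀ : 𝕍} {r : ℝ} (hball : closedBall u₀ r ⊆ c.target)
    {D : closedBall u₀ r → 𝕍 →L[ℝ] E} (hD : Continuous D)
    (hφ : ∀ y : closedBall u₀ r, fderiv ℝ (φ ∘ c.symm) (y : 𝕍) = D y) :
    chartVolume m B k φ c (c.symm '' closedBall u₀ r) = ENNReal.ofReal
      (∫ y, Real.sqrt ((-1) ^ k * (gramMatrix B (D y)).det) ∂(ballMeasure u₀ r)) := by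
  have : IsFiniteMeasure (ballMeasure u₀ r) := isFiniteMeasure_ballMeasure u₀ r
  have : CompactSpace (closedBall u₀ r) := isCompact_iff_compactSpace.1 (isCompact_closedBall u₀ r)
  have himg : c '' (c.symm '' closedBall u₀ r) = closedBall u₀ r := by
    rw [image_image]
    exact (image_congr fun u hu => c.right_inv (hball hu)).trans (image_id' _)
  have hcont : Continuous fun y => Real.sqrt ((-1) ^ k * (gramMatrix B (D y)).det) :=
    Real.continuous_sqrt.comp (continuous_const.mul (continuous_gramMatrix B hD).matrix_det)
  rw [chartVolume, himg, ofReal_integral_eq_lintegral_ofReal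
    (hcont.integrable_of_hasCompactSupport (HasCompactSupport.of_compactSpace _))
    (Filter.Eventually.of_forall fun y => Real.sqrt_nonneg _), ballMeasure,
    ← lintegral_subtype_comap measurableSet_closedBall]
  refine lintegral_congr fun y => ?_
  rw [← hφ y]
  rfl

/-- A minimal submanifold of index `0 < k < m` and positive codimension has, near any point,
compactly supported normal variations whose volume differs from that of `φ` by a quantity of the
prescribed sign `s`. Both signs occur as the induced metric has directions `ℓ` with
`g⁻¹(ℓ, ℓ) < 0` and with `g⁻¹(ℓ, ℓ) > 0`. -/
theorem exists_variation [T2Space M] {B : LinearMap.BilinForm ℝ E} (hB : B.Nondegenerate)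
    (hs : ∀ x y, B x y = B y x) {k : ℕ} (hk : 0 < k) (hkm : k < m)
    (hdim : m < Module.finrank ℝ E) {φ : M → E} (hφ : IsIndefiniteSubmanifold m B k φ)
    (hmin : IsMinimal m B k φ) {Ω : Set M} (hΩ : IsOpen Ω) (hne : Ω.Nonempty) {s : ℝ}
    (hs0 : s ≠ 0) :
    ∃ (K : Set M) (ε : ℝ) (Φ : ℝ → M → E) (c : OpenPartialHomeomorph M 𝕍) (a : ℝ → ℝ),
      IsCompact K ∧ K ⊆ Ω ∧ 0 < ε ∧ IsVariation m B k φ K ε Φ ∧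
      c ∈ IsManifold.maximalAtlas (𝓡 m) ∞ M ∧ K ⊆ c.source ∧
      (∀ t, ContMDiff (𝓡 m) 𝓘(ℝ, E) ∞ (Φ t)) ∧ (∀ t, 0 ≤ a t) ∧
      (∀ t, chartVolume m B k (Φ t) c K = ENNReal.ofReal (a t)) ∧
      ∀ t ∈ Ioo (-ε) ε, t ≠ 0 → 0 < s * (a t - a 0) := by
  obtain ⟨p, hp⟩ := hne
  set c := chartAt 𝕍 p with hcdef
  have hc : c ∈ IsManifold.maximalAtlas (𝓡 m) ∞ M := IsManifold.chart_mem_maximalAtlas p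
  have hpc : p ∈ c.source := mem_chart_source _ p
  set u₀ := c p with hu₀
  have hu₀t : u₀ ∈ c.target := c.map_source hpc
  have hpu : c.symm u₀ = p := c.left_inv hpc
  set ψ := φ ∘ c.symm with hψdef
  have hψ : ContDiffOn ℝ ∞ ψ c.target := contDiffOn_comp_symm hφ.1 hc
  have hD : ContDiffOn ℝ ∞ (fderiv ℝ ψ) c.target := hψ.fderiv_of_isOpen c.open_target le_rfl
  have hLor : ∀ u ∈ c.target, ∃ e : Module.Basis (Fin m) ℝ 𝕍,
      IsLorentzBasis (pullbackForm B (fderiv ℝ ψ u)) k e := fun u hu =>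
    ((hasIndex_inducedMetric_iff B hφ.1 hc hu).1 (hφ.2 _)).exists_isLorentzBasis
      finrank_euclideanSpace_fin fun v w => hs _ _
  have hdet : ∀ u ∈ c.target, 0 < (-1) ^ k * (gramMatrix B (fderiv ℝ ψ u)).det := fun u hu => by
    obtain ⟨e, he⟩ := hLor u hu
    exact det_gramMatrix_pos hkm.le he
  have hdet0 : ∀ u ∈ c.target, (gramMatrix B (fderiv ℝ ψ u)).det ≠ 0 := fun u hu h0 => by
    have := hdet u hu
    simp [h0] at this
  -- A normal vector at `p` that is not null, and its normal extension over the chart.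
  obtain ⟨x₀, hx₀, hx₀ne⟩ : ∃ x ∈ normalSpace m B φ p, B x x ≠ 0 := by
    refine exists_orthogonal_apply_self_ne_zero hB hs (isCompl_normalSpace hs (hφ.2 p).1) ?_
    intro htop
    have h1 := LinearMap.finrank_range_le (differential m φ p)
    rw [show LinearMap.range (differential m φ p) = ⊤ from htop, finrank_top,
      finrank_tangentSpace] at h1
    omega
  set ξ : 𝕍 → E := fun u => normalPart B x₀ (fderiv ℝ ψ u) with hξdef
  have hξ : ContDiffOn ℝ ∞ ξ c.target := contDiffOn_normalPart B x₀ hD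
  have hξn : ∀ u ∈ c.target, ∀ v, B (fderiv ℝ ψ u v) (ξ u) = 0 := fun u _ v =>
    apply_normalPart B x₀ _ v
  have hξ₀ : ξ u₀ = (gramMatrix B (fderiv ℝ ψ u₀)).det • x₀ :=
    normalPart_of_orthogonal ((mem_normalSpace_symm_iff B hφ.1 hc hu₀t x₀).1 (by rwa [hpu]))
  -- A covector `ℓ` whose square in the dual metric at `p` has the sign of `s ⟨ξ, ξ⟩`.
  obtain ⟨e, he⟩ := hLor u₀ hu₀t
  obtain ⟨a, ha⟩ : ∃ a : Fin m, 0 < s * B x₀ x₀ * sign k a := by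
    rcases lt_or_gt_of_ne (mul_ne_zero hs0 hx₀ne) with h | h
    · exact ⟨⟨0, hk.trans hkm⟩, by rw [sign_eq_neg_one hk]; linarith⟩
    · exact ⟨⟨k, hkm⟩, by rw [sign_eq_one (lt_irrefl k)]; linarith⟩
  set l : 𝕍 →L[ℝ] ℝ :=
    (B.toContinuousBilinearMap (fderiv ℝ ψ u₀ (e a))).comp (fderiv ℝ ψ u₀) with hl
  have hle : ∀ j, l (e j) = if a = j then sign k a else 0 := fun j => he a j
  set κ : 𝕍 → ℝ := fun u => s * (B (ξ u) (ξ u) *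
    trace ((gramMatrix B (fderiv ℝ ψ u))⁻¹ * squareMatrix l)) with hκ
  have hκ₀ : 0 < κ u₀ := by
    have h1 : trace ((gramMatrix B (fderiv ℝ ψ u₀))⁻¹ * squareMatrix l) = sign k a := by
      rw [trace_inv_mul_squareMatrix he]
      simp only [hle, ite_pow, mul_ite, zero_pow two_ne_zero, mul_zero, Finset.sum_ite_eq,
        Finset.mem_univ, if_true]
      rw [sq, sign_mul_self, mul_one]
    have h2 : κ u₀ = (gramMatrix B (fderiv ℝ ψ u₀)).det ^ 2 * (s * B x₀ x₀ * sign k a) := by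
      simp only [hκ, h1, hξ₀, map_smul, LinearMap.smul_apply, smul_eq_mul]
      ring
    rw [h2]
    have := hdet0 u₀ hu₀t
    positivity
  have hκc : ContinuousOn κ c.target := by
    rw [continuousOn_iff_continuous_domRestrict]
    have hDc := continuousOn_iff_continuous_domRestrict.1 hD.continuousOn
    have hξc := continuousOn_iff_continuous_domRestrict.1 hξ.continuousOn
    exact continuous_const.mul (((B.toContinuousBilinearMap.continuous.comp hξc).clm_apply hξc).mul
      ((continuous_inv_of_det_ne_zero (continuous_gramMatrix B hDc)
        fun y => hdet0 _ y.2).matrix_mul continuous_const).matrix_trace)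
  have hclose : ∀ᶠ u in 𝓝 u₀, ∀ i j, |B (fderiv ℝ ψ u (e i)) (fderiv ℝ ψ u (e j))
      - if i = j then sign k i else 0| < 1 / (m + 1) := by
    rw [Filter.eventually_all]; intro i
    rw [Filter.eventually_all]; intro j
    have hDc : ContinuousAt (fderiv ℝ ψ) u₀ :=
      hD.continuousOn.continuousAt (c.open_target.mem_nhds hu₀t)
    have h1 : ContinuousAt (fun u => |B (fderiv ℝ ψ u (e i)) (fderiv ℝ ψ u (e j))
        - if i = j then sign k i else 0|) u₀ :=
      (((B.toContinuousBilinearMap.continuous.continuousAt.comp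
        (hDc.clm_apply continuousAt_const)).clm_apply
          (hDc.clm_apply continuousAt_const)).sub continuousAt_const).abs
    refine h1.eventually_lt_const ?_
    have := he i j
    rw [pullbackForm_apply] at this
    simp only [this, sub_self, abs_zero]
    positivity
  have hΩu : ∀ᶠ u in 𝓝 u₀, c.symm u ∈ Ω :=
    (c.continuousAt_symm hu₀t).eventually (hΩ.mem_nhds (by rwa [hpu]))
  obtain ⟨r, hr, hrsub⟩ := Metric.nhds_basis_closedBall.eventually_iff.1
    (((hκc.continuousAt (c.open_target.mem_nhds hu₀t)).eventually_const_lt hκ₀).and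
      (hclose.and (hΩu.and (c.open_target.mem_nhds hu₀t))))
  have hball : closedBall u₀ r ⊆ c.target := fun u hu => (hrsub hu).2.2.2
  set K : Set M := c.symm '' closedBall u₀ r with hK
  have hKc : IsCompact K :=
    (isCompact_closedBall u₀ r).image_of_continuousOn (c.symm.continuousOn.mono hball)
  have hKs : K ⊆ c.source := by
    rintro _ ⟨u, hu, rfl⟩
    exact c.map_target (hball hu)
  -- The cut off function, and the oscillating factor.
  let η : SmoothBumpFunction (𝓡 m) p :=
    { rIn := r / 2
      rOut := r
      rIn_pos := by positivity
      rIn_lt_rOut := by linarith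
      closedBall_subset := fun u hu => by
        rw [extChartAt_target]
        exact ⟨hball hu.1, mem_range_self _⟩ }
  have hηK : ∀ q ∉ K, η q = 0 := fun q hq => by
    by_contra h0
    have h1 : q ∈ Function.support η := h0
    rw [η.support_eq_symm_image] at h1
    obtain ⟨u, hu, rfl⟩ := h1
    exact hq ⟨u, ball_subset_closedBall hu.1, rfl⟩
  set ηc : 𝕍 → ℝ := η ∘ c.symm with hηc
  have hηs : ContDiffOn ℝ ∞ ηc c.target := contDiffOn_comp_symm η.contMDiff hc
  have hη0 : ∀ u ∈ ball u₀ r, ηc u ≠ 0 := fun u hu => by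
    have : c.symm u ∈ Function.support η := by
      rw [η.support_eq_symm_image]
      exact ⟨u, ⟨hu, mem_range_self _⟩, rfl⟩
    exact this
  obtain ⟨h, hh, hJ⟩ := exists_oscillation B k c.open_target hr hball hD.continuousOn hξ hηs hdet
    hη0 l s fun u hu => (hrsub hu).1
  set f : 𝕍 → ℝ := fun v => ηc v * h v with hf
  have hfs : ContDiffOn ℝ ∞ f c.target := hηs.mul hh.contDiffOn
  set X : M → E := fun q => η q • (h (c q) • ξ (c q)) with hX
  have hXs : ContMDiff (𝓡 m) 𝓘(ℝ, E) ∞ X := by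
    refine η.contMDiff_smul ?_
    have h1 : ContDiffOn ℝ ∞ (fun u => h u • ξ u) c.target := hh.contDiffOn.smul hξ
    exact h1.contMDiffOn.comp (contMDiffOn_of_mem_maximalAtlas hc) fun q hq => c.map_source hq
  have hXK : ∀ q ∉ K, X q = 0 := fun q hq => by rw [hX]; simp [hηK q hq]
  have hXc : ∀ u ∈ c.target, X (c.symm u) = f u • ξ u := fun u hu => by
    simp only [hX, hf, hηc, c.right_inv hu, smul_smul, Function.comp_apply]
  set Φ : ℝ → M → E := fun t q => φ q + t • X q with hΦ
  have hΦs : ∀ t, ContMDiff (𝓡 m) 𝓘(ℝ, E) ∞ (Φ t) := fun t =>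
    hφ.1.add ((contMDiff_const : ContMDiff (𝓡 m) 𝓘(ℝ, ℝ) ∞ fun _ : M => t).smul hXs)
  set W : 𝕍 → 𝕍 →L[ℝ] E := fun u => productDeriv (fderiv ℝ ξ u) (ξ u) (f u) (fderiv ℝ f u) with hW
  have hΦd : ∀ t, ∀ u ∈ c.target, fderiv ℝ (Φ t ∘ c.symm) u = fderiv ℝ ψ u + t • W u :=
    fun t u hu => by
    have hev : Φ t ∘ c.symm =ᶠ[𝓝 u] fun v => ψ v + t • (f v • ξ v) := by
      filter_upwards [c.open_target.mem_nhds hu] with v hv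
      simp only [hΦ, Function.comp_apply, hXc v hv, hψdef]
    rw [hev.fderiv_eq]
    exact ((differentiableAt_of_contDiffOn hψ c.open_target hu).hasFDerivAt.add
      (((differentiableAt_of_contDiffOn hfs c.open_target hu).hasFDerivAt.smul
        (differentiableAt_of_contDiffOn hξ c.open_target hu).hasFDerivAt).const_smul t)).fderiv
  have : CompactSpace (closedBall u₀ r) := isCompact_iff_compactSpace.1 (isCompact_closedBall u₀ r)
  have : IsFiniteMeasure (ballMeasure u₀ r) := isFiniteMeasure_ballMeasure u₀ r
  have hDc := continuous_coe_of_continuousOn hball hD.continuousOn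
  have hD'c := continuous_coe_of_continuousOn hball
    (hξ.continuousOn_fderiv_of_isOpen c.open_target (by simp))
  have hξc := continuous_coe_of_continuousOn hball hξ.continuousOn
  have hfc := continuous_coe_of_continuousOn hball hfs.continuousOn
  have hdfc := continuous_coe_of_continuousOn hball
    (hfs.continuousOn_fderiv_of_isOpen c.open_target (by simp))
  have hev := eventually_volume_and_index hs hkm.le (ballMeasure u₀ r) hDc hD'c hξc hfc hdfc
    (fun y v => hξn _ (hball y.2) v) (fun y => hdet _ (hball y.2))
    (fun y => hmin.trace_crossMatrix_eq_zero hs hφ hc hξ hξn (hball y.2)) e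
    (fun y i j => (hrsub y.2).2.1 i j) s hJ
  obtain ⟨ε, hε, hεsub⟩ := Metric.eventually_nhds_iff_ball.1 hev
  rw [Real.ball_eq_Ioo, zero_sub, zero_add] at hεsub
  refine ⟨K, ε, Φ, c, fun t => ∫ y : closedBall u₀ r, Real.sqrt ((-1) ^ k *
    (gramMatrix B (fderiv ℝ ψ y + t • W y)).det) ∂(ballMeasure u₀ r), hKc, ?_, hε, ?_, hc, hKs,
    hΦs, fun t => integral_nonneg fun y => Real.sqrt_nonneg _, fun t => ?_, fun t ht ht0 => ?_⟩
  · rintro _ ⟨u, hu, rfl⟩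
    exact (hrsub hu).2.2.1
  · refine ⟨?_, ?_, ?_, ?_, ?_⟩
    · refine ContMDiff.contMDiffOn ?_
      exact (hφ.1.comp contMDiff_snd).add (contMDiff_fst.smul (hXs.comp contMDiff_snd))
    · ext q; simp [hΦ]
    · intro t _ q hq
      simp [hΦ, hXK q hq]
    · intro t ht q
      by_cases hq : q ∈ K
      · obtain ⟨u, hu, rfl⟩ := hq
        rw [hasIndex_inducedMetric_iff B (hΦs t) hc (hball hu), hΦd t u (hball hu)]
        exact (hεsub t ht).1 ⟨u, hu⟩
      · have hev : Φ t =ᶠ[𝓝 q] φ := by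
          filter_upwards [hKc.isClosed.isOpen_compl.mem_nhds hq] with q' hq'
          simp [hΦ, hXK q' hq']
        have : differential m (Φ t) q = differential m φ q := by
          ext v
          exact DFunLike.congr_fun hev.mfderiv_eq v
        rw [inducedMetric, this]
        exact hφ.2 q
    · intro q
      have hd : deriv (fun t => Φ t q) 0 = X q := by
        have h1 : HasDerivAt (fun t : ℝ => φ q + t • X q) ((1 : ℝ) • X q) 0 :=
          ((hasDerivAt_id (0 : ℝ)).smul_const (X q)).const_add (φ q)
        rw [h1.deriv, one_smul]
      rw [hd]
      by_cases hq : q ∈ c.source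
      · have hqt := c.map_source hq
        have h1 := (mem_normalSpace_symm_iff B hφ.1 hc hqt (ξ (c q))).2 (hξn _ hqt)
        rw [c.left_inv hq] at h1
        exact Submodule.smul_mem _ _ (Submodule.smul_mem _ _ h1)
      · rw [hXK q fun hqK => hq (hKs hqK)]
        exact zero_mem _
  · refine chartVolume_symm_image_closedBall B k hball
      (D := fun y : closedBall u₀ r => fderiv ℝ ψ y + t • W y) ?_ fun y => hΦd t y (hball y.2)
    exact hDc.add (Continuous.const_smul (continuous_productDeriv hD'c hξc hfc hdfc) t)
  · have := (hεsub t ht).2 ht0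
    simpa using this

/-- Both kinds of variation, in terms of the volume of arbitrary Borel sets. -/
theorem exists_increasing_and_decreasing_variation [T2Space M] {B : LinearMap.BilinForm ℝ E}
    (hB : B.Nondegenerate) (hs : ∀ x y, B x y = B y x) {k : ℕ} (hk : 0 < k) (hkm : k < m)
    (hdim : m < Module.finrank ℝ E) {φ : M → E} (hφ : IsIndefiniteSubmanifold m B k φ)
    (hmin : IsMinimal m B k φ) {Ω : Set M} (hΩ : IsOpen Ω) (hne : Ω.Nonempty) :
    (∃ (K : Set M) (ε : ℝ) (Φ : ℝ → M → E), IsCompact K ∧ K ⊆ Ω ∧ 0 < ε ∧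
      IsVariation m B k φ K ε Φ ∧ IncreasesVolume m B k φ K ε Φ) ∧
    (∃ (K : Set M) (ε : ℝ) (Φ : ℝ → M → E), IsCompact K ∧ K ⊆ Ω ∧ 0 < ε ∧
      IsVariation m B k φ K ε Φ ∧ DecreasesVolume m B k φ K ε Φ) := by
  have key : ∀ s : ℝ, s ≠ 0 → ∃ (K : Set M) (ε : ℝ) (Φ : ℝ → M → E), IsCompact K ∧ K ⊆ Ω ∧ 0 < ε ∧
      IsVariation m B k φ K ε Φ ∧ volumeOn m B k φ K ≠ ⊤ ∧ ∀ t ∈ Ioo (-ε) ε, t ≠ 0 →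
        ∃ α β : ℝ, 0 ≤ α ∧ 0 ≤ β ∧ 0 < s * (β - α) ∧ ∀ A : Set M, K ⊆ A →
          volumeOn m B k φ A ≠ ⊤ → ∃ v : ℝ≥0∞, v ≠ ⊤ ∧
            volumeOn m B k φ A = ENNReal.ofReal α + v ∧
            volumeOn m B k (Φ t) A = ENNReal.ofReal β + v := by
    intro s hs0
    obtain ⟨K, ε, Φ, c, a, hK, hKΩ, hε, hvar, hc, hKc, hΦs, ha0, hvol, hsgn⟩ :=
      exists_variation hB hs hk hkm hdim hφ hmin hΩ hne hs0
    have hKm : MeasurableSet[borel M] K := by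
      borelize M
      exact hK.isClosed.measurableSet
    have hdec : ∀ t, ∀ A, K ⊆ A → volumeOn m B k (Φ t) A
        = ENNReal.ofReal (a t) + volumeOn m B k (Φ t) (A \ K) := fun t A hA => by
      rw [← hvol t]
      exact volumeOn_eq_chartVolume_add B k (hΦs t) hc hKm hKc hA
        (by rw [hvol t]; exact ENNReal.ofReal_ne_top)
    refine ⟨K, ε, Φ, hK, hKΩ, hε, hvar, ?_, fun t ht ht0 =>
      ⟨a 0, a t, ha0 0, ha0 t, hsgn t ht ht0, fun A hA hfin => ?_⟩⟩
    · have := hdec 0 K subset_rfl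
      rw [hvar.zero, Set.sdiff_self, volumeOn_empty, add_zero] at this
      rw [this]
      exact ENNReal.ofReal_ne_top
    · have h0 := hdec 0 A hA
      rw [hvar.zero] at h0
      refine ⟨volumeOn m B k φ (A \ K), fun htop => hfin (by rw [h0, htop, add_top]), h0, ?_⟩
      rw [hdec t A hA, volumeOn_congr B k hK.isClosed fun q hq => hvar.fixed t ht q hq]
  constructor
  · obtain ⟨K, ε, Φ, hK, hKΩ, hε, hvar, hfin, h⟩ := key 1 one_ne_zero
    refine ⟨K, ε, Φ, hK, hKΩ, hε, hvar, hfin, fun t ht ht0 A _ hA hAfin => ?_⟩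
    obtain ⟨α, β, hα, hβ, hαβ, hA'⟩ := h t ht ht0
    obtain ⟨v, hv, h1, h2⟩ := hA' A hA hAfin
    rw [h1, h2]
    exact ENNReal.add_lt_add_right hv ((ENNReal.ofReal_lt_ofReal_iff_of_nonneg hα).2 (by linarith))
  · obtain ⟨K, ε, Φ, hK, hKΩ, hε, hvar, hfin, h⟩ := key (-1) (by norm_num)
    refine ⟨K, ε, Φ, hK, hKΩ, hε, hvar, hfin, fun t ht ht0 A _ hA hAfin => ?_⟩
    obtain ⟨α, β, hα, hβ, hαβ, hA'⟩ := h t ht ht0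
    obtain ⟨v, hv, h1, h2⟩ := hA' A hA hAfin
    rw [h1, h2]
    exact ENNReal.add_lt_add_right hv ((ENNReal.ofReal_lt_ofReal_iff_of_nonneg hβ).2 (by linarith))

end Variation

/-! ### The ambient metrics -/

lemma pseudoEuclideanForm_apply (n N : ℕ) (x y : EuclideanSpace ℝ (Fin N)) :
    pseudoEuclideanForm n N x y = ∑ j, sign n j * (x j * y j) := rfl

lemma pseudoEuclideanForm_symm (n N : ℕ) (x y : EuclideanSpace ℝ (Fin N)) :
    pseudoEuclideanForm n N x y = pseudoEuclideanForm n N y x := by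
  simp only [pseudoEuclideanForm_apply, mul_comm (x _)]

lemma nondegenerate_of_symm {V : Type*} [AddCommGroup V] [Module ℝ V]
    {B : LinearMap.BilinForm ℝ V} (hs : ∀ x y, B x y = B y x)
    (h : ∀ x, (∀ y, B x y = 0) → x = 0) : B.Nondegenerate :=
  ⟨h, fun y hy => h y fun x => by rw [hs]; exact hy x⟩

lemma pseudoEuclideanForm_nondegenerate (n N : ℕ) : (pseudoEuclideanForm n N).Nondegenerate := by
  refine nondegenerate_of_symm (pseudoEuclideanForm_symm n N) fun x hx => ?_
  ext i
  have h := hx (EuclideanSpace.single i 1)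
  simp only [pseudoEuclideanForm_apply, PiLp.single_apply, mul_ite, mul_one, mul_zero,
    Finset.sum_ite_eq', Finset.mem_univ, if_true] at h
  have h2 := sign_mul_self n i
  have : x i = sign n i * (sign n i * x i) := by rw [← mul_assoc, h2, one_mul]
  rw [this, h, mul_zero]; rfl

section Hermitian

variable {k m : ℕ}

lemma conj_pseudoHermitian (z w : EuclideanSpace ℂ (Fin m)) :
    conj (pseudoHermitian k m z w) = pseudoHermitian k m w z := by
  simp only [pseudoHermitian, map_sum, map_mul, Complex.conj_ofReal, Complex.conj_conj]
  exact Finset.sum_congr rfl fun j _ => by ring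

lemma pseudoHermitian_smul_right (c : ℂ) (z w : EuclideanSpace ℂ (Fin m)) :
    pseudoHermitian k m z (c • w) = conj c * pseudoHermitian k m z w := by
  simp only [pseudoHermitian, PiLp.smul_apply, smul_eq_mul, map_mul, Finset.mul_sum]
  exact Finset.sum_congr rfl fun j _ => by ring

lemma complexPseudoEuclideanForm_apply (z w : EuclideanSpace ℂ (Fin m)) :
    complexPseudoEuclideanForm k m z w = (pseudoHermitian k m z w).re := rfl

/-- The symplectic form, up to sign, as the metric paired with multiplication by `i`. -/
lemma complexPseudoEuclideanForm_I_smul (z w : EuclideanSpace ℂ (Fin m)) :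
    complexPseudoEuclideanForm k m z (Complex.I • w) = (pseudoHermitian k m z w).im := by
  rw [complexPseudoEuclideanForm_apply, pseudoHermitian_smul_right]
  simp

lemma complexPseudoEuclideanForm_symm (z w : EuclideanSpace ℂ (Fin m)) :
    complexPseudoEuclideanForm k m z w = complexPseudoEuclideanForm k m w z := by
  rw [complexPseudoEuclideanForm_apply, complexPseudoEuclideanForm_apply,
    ← conj_pseudoHermitian, Complex.conj_re]

lemma complexPseudoEuclideanForm_I_smul_symm (z w : EuclideanSpace ℂ (Fin m)) :
    complexPseudoEuclideanForm k m z (Complex.I • w)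
      = -complexPseudoEuclideanForm k m w (Complex.I • z) := by
  rw [complexPseudoEuclideanForm_I_smul, complexPseudoEuclideanForm_I_smul,
    ← conj_pseudoHermitian, Complex.conj_im]

lemma complexPseudoEuclideanForm_nondegenerate :
    (complexPseudoEuclideanForm k m).Nondegenerate := by
  refine nondegenerate_of_symm complexPseudoEuclideanForm_symm fun x hx => ?_
  ext i
  have h1 : pseudoHermitian k m x (EuclideanSpace.single i 1) = 0 :=
    Complex.ext (hx _) (by rw [← complexPseudoEuclideanForm_I_smul]; exact hx _)
  have h : (sign k i : ℂ) * x i = 0 := by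
    have : pseudoHermitian k m x (EuclideanSpace.single i 1) = (sign k i : ℂ) * x i := by
      rw [pseudoHermitian, Finset.sum_eq_single i]
      · simp
      · intro j _ hj; simp [hj]
      · simp
    rw [← this, h1]
  have h2 : (sign k i : ℂ) * sign k i = 1 := by exact_mod_cast sign_mul_self k i
  have : x i = sign k i * (sign k i * x i) := by rw [← mul_assoc, h2, one_mul]
  rw [this, h, mul_zero]; rfl

lemma finrank_real_euclideanSpace_complex :
    Module.finrank ℝ (EuclideanSpace ℂ (Fin m)) = 2 * m := by
  rw [← Module.finrank_mul_finrank ℝ ℂ, Complex.finrank_real_complex, finrank_euclideanSpace_fin]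

open Matrix in
/-- The expansion in vectors `a_j` that are orthonormal, up to the signs `ε_j`, for the
pseudo-Hermitian metric: the `j`-th coefficient of `y` is `ε_j h(y, a_j)`. -/
lemma exists_left_inverse {a : Fin m → EuclideanSpace ℂ (Fin m)}
    (ha : ∀ i j, pseudoHermitian k m (a i) (a j) = if i = j then (sign k i : ℂ) else 0) :
    ∃ N : Matrix (Fin m) (Fin m) ℂ, N * (Matrix.of fun i j => a j i) = 1 ∧
      ∀ (y : EuclideanSpace ℂ (Fin m)) j, (N *ᵥ y) j = sign k j * pseudoHermitian k m y (a j) := by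
  refine ⟨Matrix.of fun j l => sign k j * (sign k l * conj (a j l)), ?_, fun y j => ?_⟩
  · ext i j
    have h : (sign k i : ℂ) * sign k i = 1 := by exact_mod_cast sign_mul_self k i
    have h1 : ((Matrix.of fun j l => (sign k j : ℂ) * (sign k l * conj (a j l))) *
        (Matrix.of fun i j => a j i)) i j = sign k i * pseudoHermitian k m (a j) (a i) := by
      simp only [Matrix.mul_apply, Matrix.of_apply, pseudoHermitian, Finset.mul_sum]
      exact Finset.sum_congr rfl fun l _ => by ring
    rw [h1, ha, Matrix.one_apply]
    by_cases hij : i = j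
    · subst hij; simp [h]
    · simp [hij, Ne.symm hij]
  · simp only [Matrix.mulVec, dotProduct, Matrix.of_apply, pseudoHermitian, Finset.mul_sum]
    exact Finset.sum_congr rfl fun l _ => by ring

lemma holomorphicForm_ne_zero (θ : ℝ) {a : Fin m → EuclideanSpace ℂ (Fin m)}
    (ha : ∀ i j, pseudoHermitian k m (a i) (a j) = if i = j then (sign k i : ℂ) else 0) :
    holomorphicForm θ a ≠ 0 := by
  obtain ⟨N, hN, -⟩ := exists_left_inverse ha
  refine mul_ne_zero (Complex.exp_ne_zero _) fun h0 => ?_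
  have := congrArg Matrix.det hN
  rw [Matrix.det_mul, h0, mul_zero, Matrix.det_one] at this
  exact zero_ne_one this

open Matrix in
/-- Replacing `a_j` by `y` multiplies the determinant by the `j`-th coefficient of `y`. -/
lemma holomorphicForm_update (θ : ℝ) {a : Fin m → EuclideanSpace ℂ (Fin m)}
    (ha : ∀ i j, pseudoHermitian k m (a i) (a j) = if i = j then (sign k i : ℂ) else 0)
    (j : Fin m) (y : EuclideanSpace ℂ (Fin m)) :
    holomorphicForm θ (Function.update a j y)
      = holomorphicForm θ a * (sign k j * pseudoHermitian k m y (a j)) := by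
  obtain ⟨N, hN, hNy⟩ := exists_left_inverse ha
  set A : Matrix (Fin m) (Fin m) ℂ := Matrix.of fun i j => a j i
  have h1 : (Matrix.of fun i l => Function.update a j y l i) = A.updateCol j y := by
    ext i l
    by_cases hl : l = j
    · subst hl; simp
    · simp [hl, A]
  have h2 : A.adjugate = A.det • N := by
    calc A.adjugate = A.adjugate * (A * N) := by rw [mul_eq_one_comm.1 hN, Matrix.mul_one]
      _ = A.det • N := by rw [← Matrix.mul_assoc, Matrix.adjugate_mul, Matrix.smul_mul,
        Matrix.one_mul]
  have h3 : (A.updateCol j y).det = A.det * (sign k j * pseudoHermitian k m y (a j)) := by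
    rw [← Matrix.cramer_apply, Matrix.cramer_eq_adjugate_mulVec, h2, Matrix.smul_mulVec,
      Pi.smul_apply, hNy, smul_eq_mul]
  rw [holomorphicForm, holomorphicForm, h1, h3]
  ring

/-- `holomorphicForm θ` as a continuous real multilinear map, in order to differentiate it. -/
def holomorphicMultilinear (m : ℕ) (θ : ℝ) :
    ContinuousMultilinearMap ℝ (fun _ : Fin m => EuclideanSpace ℂ (Fin m)) ℂ where
  toFun := holomorphicForm θ
  map_update_add' {d} v i x y := by
    obtain rfl : d = instDecidableEqFin m := Subsingleton.elim _ _
    have h : ∀ x : EuclideanSpace ℂ (Fin m), (Matrix.of fun p l => Function.update v i x l p)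
        = (Matrix.of fun p l => v l p).updateCol i x := fun x => by
      ext p l
      by_cases hl : l = i
      · subst hl; simp
      · simp [hl]
    simp only [holomorphicForm, h]
    rw [show (⇑(x + y) : Fin m → ℂ) = ⇑x + ⇑y from rfl, Matrix.det_updateCol_add, mul_add]
  map_update_smul' {d} v i c x := by
    obtain rfl : d = instDecidableEqFin m := Subsingleton.elim _ _
    have h : ∀ x : EuclideanSpace ℂ (Fin m), (Matrix.of fun p l => Function.update v i x l p)
        = (Matrix.of fun p l => v l p).updateCol i x := fun x => by
      ext p l
      by_cases hl : l = i
      · subst hl; simp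
      · simp [hl]
    simp only [holomorphicForm, h]
    rw [show (⇑(c • x) : Fin m → ℂ) = (c : ℂ) • ⇑x from by ext; simp, Matrix.det_updateCol_smul,
      Complex.real_smul]
    ring
  cont := by
    refine continuous_const.mul (Continuous.matrix_det (continuous_matrix fun i j => ?_))
    simp only [Matrix.of_apply]
    fun_prop

end Hermitian

/-! ### Special Lagrangian submanifolds are minimal of index `k` -/

section SpecialLagrangian

open Matrix Topology

variable {k m : ℕ}

local notation "𝕍" => EuclideanSpace ℝ (Fin m)
local notation "𝔽" => EuclideanSpace ℂ (Fin m)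

/-- Let `ψ` be a Lagrangian parametrisation on which `Im (e^{iθ} dz) = 0`, with tangent vectors
`a_j = ∂_{v_j} ψ` at `u₀` that are orthonormal up to the signs `ε_j`. The cubic form
`C(u, v, w) = g(∂_u ∂_v ψ, i ∂_w ψ)` is symmetric, as `ω` vanishes, and `∑ ε_j C(v_i, v_j, v_j)` is
proportional to the derivative of `Im (e^{iθ} dz)(a_1, …, a_m)` in the direction `v_i`, hence `0`.
So the trace of the second derivative is orthogonal to the vectors `i a_i`. -/
lemma sum_second_derivative_eq_zero (θ : ℝ) {ψ : 𝕍 → 𝔽} {u₀ : 𝕍} (hψ : ContDiffAt ℝ ∞ ψ u₀)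
    (hlag : ∀ᶠ u in 𝓝 u₀, ∀ v w,
      complexPseudoEuclideanForm k m (fderiv ℝ ψ u v) (Complex.I • fderiv ℝ ψ u w) = 0)
    (v : Fin m → 𝕍)
    (hv : ∀ i j, pseudoHermitian k m (fderiv ℝ ψ u₀ (v i)) (fderiv ℝ ψ u₀ (v j))
      = if i = j then (sign k i : ℂ) else 0)
    (hphase : ∀ᶠ u in 𝓝 u₀, (holomorphicForm θ fun j => fderiv ℝ ψ u (v j)).im = 0) (i : Fin m) :
    ∑ j, sign k j * complexPseudoEuclideanForm k m (fderiv ℝ (fderiv ℝ ψ) u₀ (v j) (v j))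
      (Complex.I • fderiv ℝ ψ u₀ (v i)) = 0 := by
  set B := complexPseudoEuclideanForm k m with hB
  set D2 := fderiv ℝ (fderiv ℝ ψ) u₀ with hD2
  have hd1 : HasFDerivAt (fderiv ℝ ψ) D2 u₀ :=
    ((hψ.fderiv_right (m := ∞) le_rfl).differentiableAt (by simp)).hasFDerivAt
  have hdiff : ∀ w, HasFDerivAt (fun u => fderiv ℝ ψ u w) (D2.flip w) u₀ := fun w => by
    have := hd1.clm_apply (hasFDerivAt_const w u₀)
    refine this.congr_fderiv ?_
    ext x
    simp
  have hsymm : ∀ x y, D2 x y = D2 y x := by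
    refine fun x y => second_derivative_symmetric_of_eventually (𝕜 := ℝ) (f := ψ) ?_ hd1 x y
    filter_upwards [(hψ.of_le (m := 1) (by simp)).eventually (by simp)] with u hu
    exact (hu.differentiableAt (by simp)).hasFDerivAt
  have hcubic : ∀ x y z, B (D2 x y) (Complex.I • fderiv ℝ ψ u₀ z)
      = B (D2 x z) (Complex.I • fderiv ℝ ψ u₀ y) := fun x y z => by
    obtain ⟨T, hT, hTx⟩ := hasFDerivAt_bilin B (hdiff y) ((hdiff z).const_smul Complex.I) x
    have hT0 : T = 0 := hT.unique ((hasFDerivAt_const 0 u₀).congr_of_eventuallyEq (by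
      filter_upwards [hlag] with u hu using hu y z))
    rw [hT0] at hTx
    simp only [_root_.zero_apply, _root_.smul_apply, ContinuousLinearMap.flip_apply,
      Pi.smul_apply] at hTx
    have := complexPseudoEuclideanForm_I_smul_symm (k := k) (fderiv ℝ ψ u₀ y) (D2 x z)
    rw [← hB] at this
    linarith
  set a : Fin m → 𝔽 := fun j => fderiv ℝ ψ u₀ (v j) with ha
  have hF := HasFDerivAt.multilinear_comp (holomorphicMultilinear m θ) (fun j => hdiff (v j))
  have hIm : HasFDerivAt (fun u => (holomorphicForm θ fun j => fderiv ℝ ψ u (v j)).im)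
      (Complex.imCLM.comp (∑ j, ((holomorphicMultilinear m θ).toContinuousLinearMap a j).comp
        (D2.flip (v j)))) u₀ := Complex.imCLM.hasFDerivAt.comp u₀ hF
  have h0 := hIm.unique ((hasFDerivAt_const (0 : ℝ) u₀).congr_of_eventuallyEq hphase)
  have h1 := DFunLike.congr_fun h0 (v i)
  have hterm : ∀ j, (holomorphicMultilinear m θ).toContinuousLinearMap a j (D2 (v i) (v j))
      = holomorphicForm θ a * (sign k j * pseudoHermitian k m (D2 (v i) (v j)) (a j)) := fun j =>
    holomorphicForm_update θ hv j _
  simp only [ContinuousLinearMap.comp_apply, _root_.sum_apply, ContinuousLinearMap.flip_apply,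
    hterm, Complex.imCLM_apply, _root_.zero_apply, ← Finset.mul_sum] at h1
  have him : (holomorphicForm θ a).im = 0 := hphase.self_of_nhds
  have hre : (holomorphicForm θ a).re ≠ 0 := fun h =>
    holomorphicForm_ne_zero θ hv (Complex.ext h him)
  rw [Complex.mul_im, him, zero_mul, add_zero] at h1
  have h2 := (mul_eq_zero.1 h1).resolve_left hre
  rw [Complex.im_sum] at h2
  rw [← h2]
  refine Finset.sum_congr rfl fun j _ => ?_
  rw [Complex.im_ofReal_mul, ← complexPseudoEuclideanForm_I_smul, ← hB,
    hcubic (v j) (v j) (v i), hsymm (v j) (v i)]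

variable {M : Type*} [TopologicalSpace M] [ChartedSpace (EuclideanSpace ℝ (Fin m)) M]

lemma pseudoHermitian_differential {φ : M → 𝔽} (hφ : IsLagrangian k φ) (p : M)
    (v w : TangentSpace (𝓡 m) p) :
    pseudoHermitian k m (differential m φ p v) (differential m φ p w)
      = (inducedMetric m (complexPseudoEuclideanForm k m) φ p v w : ℂ) := by
  refine Complex.ext (by simp [inducedMetric_apply, complexPseudoEuclideanForm_apply]) ?_
  have := hφ.2.2 p v w
  rw [complexSymplecticForm, neg_eq_zero] at this
  rw [this, Complex.ofReal_im]

lemma pseudoHermitian_lorentzBasis {φ : M → 𝔽} (hφ : IsLagrangian k φ) {p : M} {j : ℕ}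
    {e : Module.Basis (Fin m) ℝ (TangentSpace (𝓡 m) p)}
    (he : IsLorentzBasis (inducedMetric m (complexPseudoEuclideanForm k m) φ p) j e) (i l : Fin m) :
    pseudoHermitian k m (differential m φ p (e i)) (differential m φ p (e l))
      = if i = l then (sign j i : ℂ) else 0 := by
  rw [pseudoHermitian_differential hφ, he i l]
  split_ifs <;> simp

lemma card_sign_neg (hkm : k ≤ m) : Fintype.card {i : Fin m // sign k i < 0} = k := by
  have h : ∀ i : Fin m, sign k i < 0 ↔ (i : ℕ) < k := fun i => by
    unfold sign; split_ifs with h <;> simp [h]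
  refine (Fintype.card_congr
    { toFun := fun i => (⟨i.1.1, (h i.1).1 i.2⟩ : Fin k)
      invFun := fun i => ⟨⟨i.1, i.2.trans_le hkm⟩, (h _).2 i.2⟩
      left_inv := fun i => rfl
      right_inv := fun i => rfl }).trans (by simp)

lemma card_neg_sign_neg (hkm : k ≤ m) : Fintype.card {i : Fin m // -sign k i < 0} = m - k := by
  have h : ∀ i : Fin m, -sign k i < 0 ↔ ¬ sign k i < 0 := fun i => by
    unfold sign; split_ifs <;> norm_num
  rw [Fintype.card_congr (Equiv.subtypeEquivRight h), Fintype.card_subtype_compl,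
    card_sign_neg hkm, Fintype.card_fin]

/-- A Lagrangian submanifold of `C_k^m` has index `k`: a Lorentz basis of its tangent plane is a
complex basis which diagonalises the pseudo-Hermitian metric. -/
lemma IsLagrangian.hasIndex (hkm : k ≤ m) {φ : M → 𝔽} (hφ : IsLagrangian k φ) (p : M) :
    HasIndex (inducedMetric m (complexPseudoEuclideanForm k m) φ p) k := by
  set g := inducedMetric m (complexPseudoEuclideanForm k m) φ p
  have hidx : HasIndex g (sigNeg g.toQuadraticMap) := ⟨hφ.2.1 p, rfl⟩
  set j := sigNeg g.toQuadraticMap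
  have hjm : j ≤ m := by
    have := sigPos_le_finrank (-g.toQuadraticMap)
    rwa [finrank_tangentSpace] at this
  obtain ⟨e, he⟩ := hidx.exists_isLorentzBasis (finrank_tangentSpace p)
    fun v w => complexPseudoEuclideanForm_symm _ _
  have hA := pseudoHermitian_lorentzBasis hφ he
  have h1 := card_neg_le_of_hermitian_congr (sign k) (sign j)
    (fun i l => differential m φ p (e i) l) hA
  have h2 := card_neg_le_of_hermitian_congr (fun i => -sign k i) (fun i => -sign j i)
    (fun i l => differential m φ p (e i) l) fun i l => by
      have := congrArg Neg.neg (hA i l)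
      simp only [pseudoHermitian, ← Finset.sum_neg_distrib, ← neg_mul] at this
      simp only [Complex.ofReal_neg]
      rw [this]
      split_ifs <;> simp
  rw [card_sign_neg hjm, card_sign_neg hkm] at h1
  rw [card_neg_sign_neg hjm, card_neg_sign_neg hkm] at h2
  have : j = k := by omega
  rwa [this] at hidx

lemma IsLorentzBasis.unitsSMul {V : Type*} [AddCommGroup V] [Module ℝ V]
    {g : LinearMap.BilinForm ℝ V} {e : Module.Basis (Fin m) ℝ V} (he : IsLorentzBasis g k e)
    (i : Fin m) : IsLorentzBasis g k (e.unitsSMul (Function.update 1 i (-1))) := fun a b => by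
  have hu : ∀ a : Fin m, ((Function.update (1 : Fin m → ℝˣ) i (-1) a : ℝˣ) : ℝ) *
      ((Function.update (1 : Fin m → ℝˣ) i (-1) a : ℝˣ) : ℝ) = 1 := fun a => by
    by_cases ha : a = i
    · subst ha; simp
    · simp [Function.update_of_ne ha]
  simp only [Module.Basis.unitsSMul_apply, Units.smul_def, map_smul, LinearMap.smul_apply,
    smul_eq_mul, he a b]
  by_cases hab : a = b
  · subst hab
    rw [if_pos rfl, ← mul_assoc, hu, one_mul]
  · simp [hab]

/-- On a special Lagrangian submanifold `e^{iθ} dz` is real on all tangent vectors: on an oriented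
Lorentz basis it is `1`, and a change of basis multiplies it by a real determinant. -/
lemma IsSpecialLagrangian.im_holomorphicForm (hk : 0 < k) (hkm : k < m) {θ : ℝ} {φ : M → 𝔽}
    {o : ∀ p : M, Orientation ℝ (TangentSpace (𝓡 m) p) (Fin m)} (hφ : IsSpecialLagrangian k θ φ o)
    (p : M) (w : Fin m → TangentSpace (𝓡 m) p) :
    (holomorphicForm θ fun j => differential m φ p (w j)).im = 0 := by
  obtain ⟨e, he, heo⟩ : ∃ e : Module.Basis (Fin m) ℝ (TangentSpace (𝓡 m) p),
      IsLorentzBasis (inducedMetric m (complexPseudoEuclideanForm k m) φ p) k e ∧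
        e.orientation = o p := by
    obtain ⟨e, he⟩ := (hφ.1.hasIndex hkm.le p).exists_isLorentzBasis (finrank_tangentSpace p)
      fun v w => complexPseudoEuclideanForm_symm _ _
    rcases e.orientation_eq_or_eq_neg (o p) with h | h
    · exact ⟨e, he, h.symm⟩
    · refine ⟨_, he.unitsSMul ⟨0, hk.trans hkm⟩, ?_⟩
      rw [Module.Basis.orientation_neg_single, h]
  have h1 := hφ.2 p e he heo
  set A : Matrix (Fin m) (Fin m) ℂ := Matrix.of fun i j => differential m φ p (e j) i
  set P : Matrix (Fin m) (Fin m) ℝ := Matrix.of fun i j => e.repr (w j) i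
  have h2 : (Matrix.of fun i j => differential m φ p (w j) i) = A * P.map Complex.ofRealHom := by
    ext i j
    conv_lhs => rw [Matrix.of_apply, ← e.sum_repr (w j)]
    simp only [map_sum, map_smul, Matrix.mul_apply, A, P, Matrix.of_apply, Matrix.map_apply]
    simp [mul_comm]
  have h3 : holomorphicForm θ (fun j => differential m φ p (w j)) = (P.det : ℂ) := by
    have h4 : (P.map Complex.ofRealHom).det = (P.det : ℂ) := (Complex.ofRealHom.map_det P).symm
    rw [holomorphicForm, h2, Matrix.det_mul, ← mul_assoc, h4]
    rw [holomorphicForm] at h1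
    rw [h1, one_mul]
  rw [h3, Complex.ofReal_im]

/-- Special Lagrangian submanifolds are minimal: `H` is orthogonal to the tangent vectors `a_i` and,
by `sum_second_derivative_eq_zero`, to the vectors `i a_i`, which together span `C_k^m`. -/
lemma IsSpecialLagrangian.isMinimal [IsManifold (𝓡 m) ∞ M] (hk : 0 < k) (hkm : k < m) {θ : ℝ}
    {φ : M → 𝔽} {o : ∀ p : M, Orientation ℝ (TangentSpace (𝓡 m) p) (Fin m)}
    (hφ : IsSpecialLagrangian k θ φ o) :
    IsMinimal m (complexPseudoEuclideanForm k m) k φ := by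
  intro p e he
  set B := complexPseudoEuclideanForm k m with hB
  have hs : ∀ x y, B x y = B y x := complexPseudoEuclideanForm_symm
  set c := chartAt 𝕍 p
  have hc : c ∈ IsManifold.maximalAtlas (𝓡 m) ∞ M := IsManifold.chart_mem_maximalAtlas p
  have hut : c p ∈ c.target := c.map_source (mem_chart_source _ p)
  set ψ := φ ∘ c.symm
  have hψ : ContDiffOn ℝ ∞ ψ c.target := contDiffOn_comp_symm hφ.1.1 hc
  have hdφ : ∀ v : 𝕍, differential m φ p v = fderiv ℝ ψ (c p) v := fun v =>
    differential_eq_fderiv_extChartAt (mdifferentiableAt_of_contMDiff hφ.1.1 p) v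
  -- The basis as a family of coordinate vectors, by the identification of `T_pM` with `ℝ^m`.
  obtain ⟨v, hv⟩ : ∃ v : Fin m → 𝕍, ∀ j, v j = e j := ⟨fun j => e j, fun _ => rfl⟩
  have hdv : ∀ j, differential m φ p (e j) = fderiv ℝ ψ (c p) (v j) := fun j => by
    rw [hv]; exact hdφ (e j)
  have hH := sum_second_derivative_eq_zero (k := k) θ (hψ.contDiffAt (c.open_target.mem_nhds hut))
    (by
      filter_upwards [c.open_target.mem_nhds hut] with u hu x y
      obtain ⟨L, hL⟩ := exists_chart_equiv (E := 𝔽) hc hu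
      have hLφ := hL φ (mdifferentiableAt_of_contMDiff hφ.1.1 _)
      rw [← hLφ, ← hLφ, complexPseudoEuclideanForm_I_smul, pseudoHermitian_differential hφ.1,
        Complex.ofReal_im])
    v
    (fun i j => by
      rw [← hdv, ← hdv]
      exact pseudoHermitian_lorentzBasis hφ.1 he i j)
    (by
      filter_upwards [c.open_target.mem_nhds hut] with u hu
      obtain ⟨L, hL⟩ := exists_chart_equiv (E := 𝔽) hc hu
      have hLφ := hL φ (mdifferentiableAt_of_contMDiff hφ.1.1 _)
      rw [show (fun j => fderiv ℝ ψ u (v j)) = fun j => differential m φ (c.symm u) (L (v j)) from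
        funext fun j => (hLφ (v j)).symm]
      exact hφ.im_holomorphicForm hk hkm _ fun j => L (v j))
  have hIn : ∀ i, Complex.I • differential m φ p (e i) ∈ normalSpace m B φ p := fun i => by
    rw [mem_normalSpace_iff]
    intro v
    rw [complexPseudoEuclideanForm_I_smul, pseudoHermitian_differential hφ.1, Complex.ofReal_im]
  set H := meanCurvature m B k φ p e with hHdef
  have hHn : H ∈ normalSpace m B φ p := by
    refine Submodule.sum_mem _ fun j _ => Submodule.smul_mem _ _ ?_
    rw [secondFundamentalForm, normalProjection, dif_pos (isCompl_normalSpace hs (hφ.1.2.1 p)).symm]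
    exact Submodule.projection_apply_mem _ _
  have h1 : ∀ i, B H (Complex.I • differential m φ p (e i)) = 0 := fun i => by
    simp only [hHdef, meanCurvature, secondFundamentalForm, map_sum, LinearMap.sum_apply, map_smul,
      LinearMap.smul_apply, smul_eq_mul, apply_normalProjection hs (hφ.1.2.1 p) (hIn i)]
    rw [hdv]
    refine Eq.trans (Finset.sum_congr rfl fun j _ => ?_) (hH i)
    rw [hv i, hv j]; rfl
  have h2 : ∀ i, B H (differential m φ p (e i)) = 0 := fun i => by
    rw [hs]
    exact (mem_normalSpace_iff B φ p H).1 hHn (e i)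
  have h3 : ∀ i, pseudoHermitian k m H (differential m φ p (e i)) = 0 := fun i =>
    Complex.ext (h2 i) (by rw [← complexPseudoEuclideanForm_I_smul]; exact h1 i)
  obtain ⟨N, hN, hNy⟩ := exists_left_inverse (pseudoHermitian_lorentzBasis hφ.1 he)
  have h4 : N *ᵥ (H : Fin m → ℂ) = 0 := by
    ext j
    rw [hNy, h3, mul_zero]; rfl
  have h5 : (H : Fin m → ℂ) = 0 := by
    rw [← Matrix.one_mulVec (H : Fin m → ℂ), ← mul_eq_one_comm.1 hN, ← Matrix.mulVec_mulVec, h4,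
      Matrix.mulVec_zero]
  ext i
  exact congrFun h5 i

end SpecialLagrangian

end IndefiniteSubmanifold

end

open IndefiniteSubmanifold in
theorem theoremA {m k : ℕ} (hk : 0 < k) (hkm : k < m)
    (M : Type*) [TopologicalSpace M] [T2Space M] [SecondCountableTopology M]
    [ChartedSpace (EuclideanSpace ℝ (Fin m)) M] [IsManifold (𝓡 m) ∞ M] :
    (∀ (n N : ℕ), n ≤ N → m < N → ∀ φ : M → EuclideanSpace ℝ (Fin N),
      IsIndefiniteSubmanifold m (pseudoEuclideanForm n N) k φ →
      IsMinimal m (pseudoEuclideanForm n N) k φ →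
      ∀ Ω : Set M, IsOpen Ω → Ω.Nonempty →
        (∃ (K : Set M) (ε : ℝ) (Φ : ℝ → M → EuclideanSpace ℝ (Fin N)),
          IsCompact K ∧ K ⊆ Ω ∧ 0 < ε ∧ IsVariation m (pseudoEuclideanForm n N) k φ K ε Φ ∧
          IncreasesVolume m (pseudoEuclideanForm n N) k φ K ε Φ) ∧
        (∃ (K : Set M) (ε : ℝ) (Φ : ℝ → M → EuclideanSpace ℝ (Fin N)),
          IsCompact K ∧ K ⊆ Ω ∧ 0 < ε ∧ IsVariation m (pseudoEuclideanForm n N) k φ K ε Φ ∧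
          DecreasesVolume m (pseudoEuclideanForm n N) k φ K ε Φ)) ∧
    (∀ (θ : ℝ) (φ : M → EuclideanSpace ℂ (Fin m))
      (o : ∀ p : M, Orientation ℝ (TangentSpace (𝓡 m) p) (Fin m)),
      IsSpecialLagrangian k θ φ o →
      ∀ Ω : Set M, IsOpen Ω → Ω.Nonempty →
        ¬ IsVolumeMinimizingOn m (complexPseudoEuclideanForm k m) k φ Ω ∧
        ¬ IsVolumeMaximizingOn m (complexPseudoEuclideanForm k m) k φ Ω) := by
  refine ⟨fun n N _ hmN φ hφ hmin Ω hΩ hne => ?_, fun θ φ o hφ Ω hΩ hne => ?_⟩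
  · exact exists_increasing_and_decreasing_variation (pseudoEuclideanForm_nondegenerate n N)
      (pseudoEuclideanForm_symm n N) hk hkm (by rwa [finrank_euclideanSpace_fin]) hφ hmin hΩ hne
  · obtain ⟨⟨K, ε, Φ, hK, hKΩ, hε, hvar, hfin, hinc⟩, K', ε', Φ', hK', hKΩ', hε', hvar', hfin',
      hdec⟩ := exists_increasing_and_decreasing_variation
        complexPseudoEuclideanForm_nondegenerate complexPseudoEuclideanForm_symm hk hkm
        (by rw [finrank_real_euclideanSpace_complex]; omega)
        ⟨hφ.1.1, hφ.1.hasIndex hkm.le⟩ (hφ.isMinimal hk hkm) hΩ hne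
    borelize M
    constructor
    · intro hcon
      have ht : ε' / 2 ∈ Set.Ioo (-ε') ε' := ⟨by linarith, by linarith⟩
      exact absurd (hcon K' ε' Φ' hK' hKΩ' hε' hvar' _ ht)
        (not_le.2 (hdec _ ht (by positivity) K' hK'.isClosed.measurableSet subset_rfl hfin'))
    · intro hcon
      have ht : ε / 2 ∈ Set.Ioo (-ε) ε := ⟨by linarith, by linarith⟩
      exact absurd (hcon K ε Φ hK hKΩ hε hvar _ ht)
        (not_le.2 (hinc _ ht (by positivity) K hK.isClosed.measurableSet subset_rfl hfin))
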